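/- Let $V$ be the split real quadratic space of dimension $8$: it has a basis $b_{\pm 1},\dots,b_{\pm 4}$ with $(b_i,b_{-j})=\delta_{ij}$ and $(b_i,b_j)=(b_{-i},b_{-j})=0$ for $1\le i,j\le 4$, so $(\cdot,\cdot)$ has signature $(4,4)$. Let $G(\mathbf R)=\mathrm{SO}(V)$, and identify its Lie algebra with $\wedge^2 V$, where $v\wedge w$ acts by $x\mapsto (w,x)v-(v,x)w$. Put $(u_1,u_2,w_1,w_2)=\big(\tfrac{b_1+b_{-1}}{\sqrt2},\tfrac{b_2+b_{-2}}{\sqrt2},\tfrac{b_3+b_{-3}}{\sqrt2},\tfrac{b_4+b_{-4}}{\sqrt2}\big)$, an orthonormal basis of the $+1$-eigenspace $V^+$ of the involution $b_j\leftrightarrow b_{-j}$. The distinguished $\mathfrak{sl}_2\subset\wedge^2V\otimes\mathbf C$ is spanned by $$e^+=\tfrac12(u_1-iu_2)\wedge(w_1-iw_2),\quad h^+=i(u_1\wedge u_2+w_1\wedge w_2),\quad f^+=-\tfrac12(u_1+iu_2)\wedge(w_1+iw_2),$$ and is identified with $\mathrm{Sym}^2(\mathbf C^2)$ by $e^+=-x^2$,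 $h^+=2xy$, $f^+=y^2$. Let $\mathrm{pr}:\wedge^2V\to\mathrm{Sym}^2(\mathbf C^2)$ be the orthogonal projection onto this $\mathfrak{sl}_2$ with respect to the invariant trace form. For $X\in \mathrm{Sym}^2(\mathbf C^2)$ write $X^\ell$ for its $\ell$-th power in $\mathbf V_\ell=\mathrm{Sym}^{2\ell}(\mathbf C^2)$, and let $\|\cdot\|$ denote the $\mathrm{SU}(2)$-invariant Hermitian norm on $\mathrm{Sym}^k(\mathbf C^2)$, normalized by $\|x^k\|=1$ (it is unique up to scaling). Let $v_1,v_2\in V$ span a positive-definite two-plane, let $H(\mathbf R)=H_{v_1,v_2}(\mathbf R)$ be the pointwise stabilizer of $v_1,v_2$ in $G(\mathbf R)$, and define $$B_{[v_1,v_2]}:G(\mathbf R)\to\mathbf V_\ell,\qquad B_{[v_1,v_2]}(g)=\frac{\mathrm{pr}(\mathrm{Ad}(g^{-1})(v_1\wedge v_2))^{\ell}}{\|\mathrm{pr}(\mathrm{Ad}(g^{-1})(v_1\wedge v_2))\|^{2\ell+1}},$$ which is left $H(\mathbf R)$-invariant. **Theorem.** Let $\ell\ge 22$ be an integer. Then for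 every right $G(\mathbf R)$-invariant, locally finite Borel measure $dg$ on $H(\mathbf R)\backslash G(\mathbf R)$, the function $g\mapsto\|B_{[v_1,v_2]}(g)\|$ is integrable, i.e. the integral $$\int_{H(\mathbf R)\backslash G(\mathbf R)}\|B_{[v_1,v_2]}(g)\|\,dg$$ is finite. -/

import Mathlib

open MeasureTheory

namespace SplitSO8

/-- Indices for the hyperbolic basis `b_1, …, b_4, b_{-1}, …, b_{-4}` of the split
eight-dimensional quadratic space: `Sum.inl j` stands for `b_{j+1}` and `Sum.inr j` for
`b_{-(j+1)}`. -/
abbrev Idx : Type := Fin 4 ⊕ Fin 4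

/-- The space `V(R)`, in coordinates with respect to the hyperbolic basis. -/
abbrev V (R : Type*) : Type _ := Idx → R

/-- The Gram matrix of the bilinear form: `(b_i, b_{-j}) = δ_{ij}` and
`(b_i, b_j) = (b_{-i}, b_{-j}) = 0`. -/
def J (R : Type*) [CommRing R] : Matrix Idx Idx R :=
  Matrix.fromBlocks 0 1 1 0

/-- The bilinear form `(x, y)` on `V(R)`; it has signature `(4, 4)` for `R = ℝ`. -/
def bil {R : Type*} [CommRing R] (x y : V R) : R :=
  x ⬝ᵥ (J R).mulVec y

/-- The real group `G(ℝ) = SO(V)(ℝ)`, with the topology induced from the matrix entries. -/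
def G : Subgroup (Matrix.SpecialLinearGroup Idx ℝ) where
  carrier := {g | (g : Matrix Idx Idx ℝ).transpose * J ℝ * (g : Matrix Idx Idx ℝ) = J ℝ}
  one_mem' := by simp
  mul_mem' := by
    intro a b ha hb
    simp only [Set.mem_ofPred_eq] at ha hb ⊢
    rw [Matrix.SpecialLinearGroup.coe_mul, Matrix.transpose_mul]
    calc _ = (b : Matrix Idx Idx ℝ).transpose *
          ((a : Matrix Idx Idx ℝ).transpose * J ℝ * (a : Matrix Idx Idx ℝ)) *
            (b : Matrix Idx Idx ℝ) := by simp only [Matrix.mul_assoc]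
      _ = _ := by rw [ha, hb]
  inv_mem' := by
    intro a ha
    simp only [Set.mem_ofPred_eq] at ha ⊢
    have h1 : (a : Matrix Idx Idx ℝ) * ((a⁻¹ : Matrix.SpecialLinearGroup Idx ℝ) :
        Matrix Idx Idx ℝ) = 1 := by
      rw [← Matrix.SpecialLinearGroup.coe_mul, mul_inv_cancel, Matrix.SpecialLinearGroup.coe_one]
    have h2 : ((a⁻¹ : Matrix.SpecialLinearGroup Idx ℝ) : Matrix Idx Idx ℝ).transpose *
        (a : Matrix Idx Idx ℝ).transpose = 1 := by
      rw [← Matrix.transpose_mul, h1, Matrix.transpose_one]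
    generalize ((a⁻¹ : Matrix.SpecialLinearGroup Idx ℝ) : Matrix Idx Idx ℝ) = c at *
    calc c.transpose * J ℝ * c
        = c.transpose * ((a : Matrix Idx Idx ℝ).transpose * J ℝ * (a : Matrix Idx Idx ℝ)) * c := by
          rw [ha]
      _ = (c.transpose * (a : Matrix Idx Idx ℝ).transpose) * J ℝ *
          ((a : Matrix Idx Idx ℝ) * c) := by simp only [Matrix.mul_assoc]
      _ = J ℝ := by rw [h1, h2]; simp

/-- The `8 × 8` matrix of an element of `G(ℝ)`. -/
def mat (g : G) : Matrix Idx Idx ℝ := ((g : Matrix.SpecialLinearGroup Idx ℝ) : Matrix Idx Idx ℝ)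

theorem mat_one : mat 1 = 1 := by simp [mat]

theorem mat_mul (g h : G) : mat (g * h) = mat g * mat h := by simp [mat]

theorem mat_inv_mulVec {g : G} {v : V ℝ} (h : (mat g).mulVec v = v) :
    (mat g⁻¹).mulVec v = v := by
  conv_lhs => rw [← h]
  rw [Matrix.mulVec_mulVec, ← mat_mul, inv_mul_cancel, mat_one, Matrix.one_mulVec]

/-- `H_{v₁,v₂}(ℝ)`: the pointwise stabilizer of `v₁` and `v₂` in `G(ℝ)`. -/
def H (v₁ v₂ : V ℝ) : Subgroup G where
  carrier := {g | (mat g).mulVec v₁ = v₁ ∧ (mat g).mulVec v₂ = v₂}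
  one_mem' := by simp [mat_one]
  mul_mem' := by
    rintro a b ⟨ha1, ha2⟩ ⟨hb1, hb2⟩
    exact ⟨by rw [mat_mul, ← Matrix.mulVec_mulVec, hb1, ha1],
      by rw [mat_mul, ← Matrix.mulVec_mulVec, hb2, ha2]⟩
  inv_mem' := by
    rintro a ⟨ha1, ha2⟩
    exact ⟨mat_inv_mulVec ha1, mat_inv_mulVec ha2⟩

/-- `v₁` and `v₂` span a two-plane on which the bilinear form is positive definite. -/
def SpansPosDefPlane (v₁ v₂ : V ℝ) : Prop :=
  LinearIndependent ℝ ![v₁, v₂] ∧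
    ∀ x ∈ Submodule.span ℝ ({v₁, v₂} : Set (V ℝ)), x ≠ 0 → 0 < bil x x

/-! ### The homogeneous space -/

/-- The quotient `H_{v₁,v₂}(ℝ) \ G(ℝ)` (cosets `H g`). -/
def HQuot (v₁ v₂ : V ℝ) : Type := Quotient (QuotientGroup.rightRel (H v₁ v₂))

/-- The quotient topology. -/
instance (v₁ v₂ : V ℝ) : TopologicalSpace (HQuot v₁ v₂) :=
  inferInstanceAs (TopologicalSpace (Quotient (QuotientGroup.rightRel (H v₁ v₂))))

instance (v₁ v₂ : V ℝ) : MeasurableSpace (HQuot v₁ v₂) := borel _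

instance (v₁ v₂ : V ℝ) : BorelSpace (HQuot v₁ v₂) := ⟨rfl⟩

/-- Right translation `H x ↦ H x g` on `H_{v₁,v₂}(ℝ) \ G(ℝ)`. -/
def rightTranslate (v₁ v₂ : V ℝ) (g : G) : HQuot v₁ v₂ → HQuot v₁ v₂ :=
  Quotient.map (fun x : G => x * g) (by
    intro a b hab
    change QuotientGroup.rightRel (H v₁ v₂) a b at hab
    change QuotientGroup.rightRel (H v₁ v₂) (a * g) (b * g)
    rw [QuotientGroup.rightRel_apply] at hab ⊢
    simpa [mul_assoc] using hab)

/-- Invariance of a measure on `H_{v₁,v₂}(ℝ) \ G(ℝ)` under right translation by `G(ℝ)`. -/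
def IsRightInvariant {v₁ v₂ : V ℝ} (μ : Measure (HQuot v₁ v₂)) : Prop :=
  ∀ g : G, μ.map (rightTranslate v₁ v₂ g) = μ

/-! ### The Lie algebra and its distinguished `𝔰𝔩₂` -/

/-- `v ∧ w` as an element of the Lie algebra of `SO(V)`: it is the endomorphism
`x ↦ (w, x) v - (v, x) w` (see `wedge_mulVec`). -/
def wedge {R : Type*} [CommRing R] (v w : V R) : Matrix Idx Idx R :=
  Matrix.vecMulVec v ((J R).mulVec w) - Matrix.vecMulVec w ((J R).mulVec v)

theorem J_symm (R : Type*) [CommRing R] : (J R).transpose = J R := by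
  simp [J, Matrix.fromBlocks_transpose]

theorem wedge_mulVec {R : Type*} [CommRing R] (v w x : V R) :
    (wedge v w).mulVec x = bil w x • v - bil v x • w := by
  have key : ∀ a : V R, (J R).mulVec a ⬝ᵥ x = bil a x := by
    intro a
    rw [bil, Matrix.dotProduct_mulVec, ← Matrix.mulVec_transpose, J_symm]
  ext i
  simp only [wedge, Matrix.sub_mulVec, Matrix.vecMulVec_mulVec, key]
  simp [mul_comm]

/-- The adjoint action of `g ∈ G(ℝ)` on the Lie algebra. -/
def Ad (g : G) (Y : Matrix Idx Idx ℝ) : Matrix Idx Idx ℝ := mat g * Y * mat g⁻¹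

/-- The orthonormal basis `u_1, u_2, v_1, v_2` of `V⁺` (listed as `frame 0, …, frame 3`):
`frame j = (b_{j+1} + b_{-(j+1)}) / √2`. -/
noncomputable def frame (j : Fin 4) : V ℂ :=
  ((Real.sqrt 2 : ℝ) : ℂ)⁻¹ • (Pi.single (Sum.inl j) 1 + Pi.single (Sum.inr j) 1)

/-- `e⁺ = ½ (u_1 - i u_2) ∧ (v_1 - i v_2)`. -/
noncomputable def ePlus : Matrix Idx Idx ℂ :=
  (1 / 2 : ℂ) • wedge (frame 0 - Complex.I • frame 1) (frame 2 - Complex.I • frame 3)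

/-- `h⁺ = i (u_1 ∧ u_2 + v_1 ∧ v_2)`. -/
noncomputable def hPlus : Matrix Idx Idx ℂ :=
  Complex.I • (wedge (frame 0) (frame 1) + wedge (frame 2) (frame 3))

/-- `f⁺ = -½ (u_1 + i u_2) ∧ (v_1 + i v_2)`. -/
noncomputable def fPlus : Matrix Idx Idx ℂ :=
  (-(1 / 2) : ℂ) • wedge (frame 0 + Complex.I • frame 1) (frame 2 + Complex.I • frame 3)

/-- `Sym^k(ℂ²)`, as the space of binary forms of degree `k` in `x = X 0` and `y = X 1`. -/
abbrev Sym (k : ℕ) : Type := MvPolynomial.homogeneousSubmodule (Fin 2) ℂ k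

/-- The `SU(2)`-invariant Hermitian norm on `Sym^k(ℂ²)`, normalized by `‖x^k‖ = 1`:
`‖∑ c_j x^j y^{k-j}‖² = ∑ |c_j|² / (k choose j)`. -/
noncomputable def symNorm (k : ℕ) (p : Sym k) : ℝ :=
  Real.sqrt (∑ j ∈ Finset.range (k + 1),
    ‖MvPolynomial.coeff (Finsupp.single 0 j + Finsupp.single 1 (k - j))
      (p : MvPolynomial (Fin 2) ℂ)‖ ^ 2 / (k.choose j : ℝ))

/-- The `ℓ`-th power map `Sym²(ℂ²) → 𝐕_ℓ = Sym^{2ℓ}(ℂ²)`. -/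
noncomputable def symPow (ℓ : ℕ) (p : Sym 2) : Sym (2 * ℓ) :=
  ⟨(p : MvPolynomial (Fin 2) ℂ) ^ ℓ,
    (MvPolynomial.mem_homogeneousSubmodule _ _).2
      (((MvPolynomial.mem_homogeneousSubmodule _ _).1 p.2).pow ℓ)⟩

/-- The element `a e⁺ + b h⁺ + c f⁺` of the distinguished `𝔰𝔩₂`, seen in `Sym²(ℂ²)` through the
identification `e⁺ = -x²`, `h⁺ = 2xy`, `f⁺ = y²`. -/
noncomputable def toSym2 (a b c : ℂ) : Sym 2 :=
  ⟨a • (-(MvPolynomial.X 0) ^ 2) + b • (2 * MvPolynomial.X 0 * MvPolynomial.X 1) +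
      c • (MvPolynomial.X 1) ^ 2, by
    have h0 : (MvPolynomial.X 0 : MvPolynomial (Fin 2) ℂ) ^ 2 ∈
        MvPolynomial.homogeneousSubmodule (Fin 2) ℂ 2 := MvPolynomial.isHomogeneous_X_pow 0 2
    have h1 : (MvPolynomial.X 1 : MvPolynomial (Fin 2) ℂ) ^ 2 ∈
        MvPolynomial.homogeneousSubmodule (Fin 2) ℂ 2 := MvPolynomial.isHomogeneous_X_pow 1 2
    have h01 : (2 * MvPolynomial.X 0 * MvPolynomial.X 1 : MvPolynomial (Fin 2) ℂ) ∈
        MvPolynomial.homogeneousSubmodule (Fin 2) ℂ 2 := by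
      have h : (MvPolynomial.X 0 * MvPolynomial.X 1 : MvPolynomial (Fin 2) ℂ) ∈
          MvPolynomial.homogeneousSubmodule (Fin 2) ℂ 2 :=
        (MvPolynomial.isHomogeneous_X ℂ 0).mul (MvPolynomial.isHomogeneous_X ℂ 1)
      rw [mul_assoc, two_mul]
      exact Submodule.add_mem _ h h
    exact Submodule.add_mem _ (Submodule.add_mem _
      (Submodule.smul_mem _ _ (Submodule.neg_mem _ h0)) (Submodule.smul_mem _ _ h01))
      (Submodule.smul_mem _ _ h1)⟩

/-- The `K⁰`-equivariant projection of the complexified Lie algebra onto its distinguished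
`𝔰𝔩₂ = ⟨e⁺, h⁺, f⁺⟩`, followed by the identification with `Sym²(ℂ²)`. It is the orthogonal
projection for the invariant trace form `(Y, Z) ↦ tr(Y Z)`, a multiple of the Killing form, for
which `e⁺` pairs only with `f⁺` and `h⁺` only with itself inside this `𝔰𝔩₂`. -/
noncomputable def prSU2 (Y : Matrix Idx Idx ℂ) : Sym 2 :=
  toSym2 ((Y * fPlus).trace / (ePlus * fPlus).trace) ((Y * hPlus).trace / (hPlus * hPlus).trace)
    ((Y * ePlus).trace / (fPlus * ePlus).trace)

/-! ### The function `B` -/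

/-- `pr_{𝔰𝔲₂}(Ad(g⁻¹) (v₁ ∧ v₂))`. -/
noncomputable def prAd (v₁ v₂ : V ℝ) (g : G) : Sym 2 :=
  prSU2 ((Ad g⁻¹ (wedge v₁ v₂)).map (fun t : ℝ => (t : ℂ)))

/-- `B_{[v₁,v₂]}(g) = pr(g⁻¹ (v₁ ∧ v₂))^ℓ / ‖pr(g⁻¹ (v₁ ∧ v₂))‖^{2ℓ+1}`, with values in
`𝐕_ℓ = Sym^{2ℓ}(ℂ²)`. -/
noncomputable def B (ℓ : ℕ) (v₁ v₂ : V ℝ) (g : G) : Sym (2 * ℓ) :=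
  ((symNorm 2 (prAd v₁ v₂ g) ^ (2 * ℓ + 1) : ℝ) : ℂ)⁻¹ • symPow ℓ (prAd v₁ v₂ g)

theorem Ad_mul (g h : G) (Y : Matrix Idx Idx ℝ) : Ad (g * h) Y = Ad g (Ad h Y) := by
  simp [Ad, mat_mul, Matrix.mul_assoc]

theorem Ad_wedge (g : G) (v w : V ℝ) :
    Ad g (wedge v w) = wedge ((mat g).mulVec v) ((mat g).mulVec w) := by
  have hJ : (mat g).transpose * J ℝ * mat g = J ℝ := g.2
  have h1 : mat g * mat g⁻¹ = 1 := by rw [← mat_mul, mul_inv_cancel, mat_one]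
  have h2 : (mat g⁻¹).transpose * J ℝ = J ℝ * mat g := by
    have h3 : (mat g⁻¹).transpose * (mat g).transpose = 1 := by
      rw [← Matrix.transpose_mul, h1, Matrix.transpose_one]
    calc (mat g⁻¹).transpose * J ℝ
        = (mat g⁻¹).transpose * ((mat g).transpose * J ℝ * mat g) := by rw [hJ]
      _ = ((mat g⁻¹).transpose * (mat g).transpose) * (J ℝ * mat g) := by
          simp only [Matrix.mul_assoc]
      _ = _ := by rw [h3, Matrix.one_mul]
  have key : ∀ a b : V ℝ, mat g * Matrix.vecMulVec a ((J ℝ).mulVec b) * mat g⁻¹ =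
      Matrix.vecMulVec ((mat g).mulVec a) ((J ℝ).mulVec ((mat g).mulVec b)) := by
    intro a b
    rw [Matrix.mul_vecMulVec, Matrix.vecMulVec_mul, ← Matrix.mulVec_transpose,
      Matrix.mulVec_mulVec, h2, ← Matrix.mulVec_mulVec]
  simp only [Ad, wedge, Matrix.mul_sub, Matrix.sub_mul, key]

/-- Left invariance of `B_{[v₁,v₂]}` under `H_{v₁,v₂}(ℝ)`. -/
theorem B_left_invariant (ℓ : ℕ) (v₁ v₂ : V ℝ) {h : G} (hh : h ∈ H v₁ v₂) (g : G) :
    B ℓ v₁ v₂ (h * g) = B ℓ v₁ v₂ g := by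
  have hinv := (H v₁ v₂).inv_mem hh
  have : prAd v₁ v₂ (h * g) = prAd v₁ v₂ g := by
    rw [prAd, prAd, mul_inv_rev, Ad_mul, Ad_wedge h⁻¹, hinv.1, hinv.2]
  rw [B, B, this]

/-- `B_{[v₁,v₂]}` as a function on `H_{v₁,v₂}(ℝ) \ G(ℝ)`. -/
noncomputable def BQuot (ℓ : ℕ) (v₁ v₂ : V ℝ) : HQuot v₁ v₂ → Sym (2 * ℓ) :=
  Quotient.lift (B ℓ v₁ v₂) (by
    intro a b hab
    change QuotientGroup.rightRel (H v₁ v₂) a b at hab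
    rw [QuotientGroup.rightRel_apply] at hab
    have := B_left_invariant ℓ v₁ v₂ hab a
    rw [inv_mul_cancel_right] at this
    exact this.symm)

end SplitSO8

namespace SplitSO8


/-! Split `V = V⁺ ⊕ V⁻` and attach to a coset `Hg` the area of the parallelogram spanned by the
`V⁺`-components of `g⁻¹v₁` and `g⁻¹v₂` (`quotArea`). The distinguished `𝔰𝔩₂` is one of the two
ideals of the complexified `𝔰𝔬(V⁺)`, so `pr` takes one self-dual half of a decomposable bivector; by
the Plücker relation its norm is exactly the area divided by `√2` (`symNorm_prAd`). Hence `‖B‖` is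
at most a constant times the area to the power `-(ℓ+1)` (`symNorm_B_le`). The area is bounded below
by a positive constant, so it remains to see that its sublevel sets have finite measure and grow
slowly enough.

Finiteness: an orthonormal pair of bounded area is carried to a fixed one by a group element of
bounded norm (`IsFrame.exists_bounded_group`), so a sublevel set lies in the image of a compact set.

Growth is obtained without any formula for the invariant measure. If the area is large, the longer
vector of a suitably rotated pair is nearly isotropic, and a hyperbolic reflection adapted to its
directions in `V⁺` and `V⁻` shrinks the area by at least 128. An approximate direction is enough, so
`4097 ^ 8` reflections serve all pairs (`exists_contracting`). Thus `{area ≤ 128 R}` is covered by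
`4097 ^ 8 + 1` sets, each `{area ≤ R}` or a translate of it, and invariance bounds the measure. As
`4097 ^ 8 + 1 < 128 ^ 23`, a geometric series converges once `ℓ + 1 ≥ 23`
(`lintegral_lt_top_of_growth`). There is room to spare: `128 ^ 14` already exceeds the count. -/

/-! ### The decomposition of `V` into `V⁺` and `V⁻` -/

/-- The Euclidean space `ℝ⁴`, a model of both `V⁺` and `V⁻`. -/
abbrev E : Type := EuclideanSpace ℝ (Fin 4)

/-- The component of a vector in the `+1`-eigenspace `V⁺` of `b_j ↔ b_{-j}`. -/
noncomputable def plus : V ℝ →ₗ[ℝ] E where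
  toFun v := WithLp.toLp 2 fun j => (√2)⁻¹ * (v (Sum.inl j) + v (Sum.inr j))
  map_add' v w := by ext j; simp; ring
  map_smul' a v := by ext j; simp; ring

/-- The component of a vector in the `-1`-eigenspace `V⁻` of `b_j ↔ b_{-j}`. -/
noncomputable def minus : V ℝ →ₗ[ℝ] E where
  toFun v := WithLp.toLp 2 fun j => (√2)⁻¹ * (v (Sum.inl j) - v (Sum.inr j))
  map_add' v w := by ext j; simp; ring
  map_smul' a v := by ext j; simp; ring

/-- The vector with given components in `V⁺` and `V⁻`. -/
noncomputable def glue (x y : E) : V ℝ :=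
  Sum.elim (fun j => (√2)⁻¹ * (x j + y j)) (fun j => (√2)⁻¹ * (x j - y j))

theorem inv_sqrt_two_mul_self : (√2)⁻¹ * (√2)⁻¹ = (1 / 2 : ℝ) := by
  rw [← mul_inv, Real.mul_self_sqrt (by norm_num)]; norm_num

@[simp] theorem plus_glue (x y : E) : plus (glue x y) = x := by
  ext j
  simp only [plus, glue, LinearMap.coe_mk, AddHom.coe_mk, Sum.elim_inl, Sum.elim_inr]
  linear_combination (2 * x j) * inv_sqrt_two_mul_self

@[simp] theorem minus_glue (x y : E) : minus (glue x y) = y := by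
  ext j
  simp only [minus, glue, LinearMap.coe_mk, AddHom.coe_mk, Sum.elim_inl, Sum.elim_inr]
  linear_combination (2 * y j) * inv_sqrt_two_mul_self

theorem glue_plus_minus (v : V ℝ) : glue (plus v) (minus v) = v := by
  ext j
  rcases j with j | j
  · simp only [plus, minus, glue, LinearMap.coe_mk, AddHom.coe_mk, Sum.elim_inl]
    linear_combination (2 * v (Sum.inl j)) * inv_sqrt_two_mul_self
  · simp only [plus, minus, glue, LinearMap.coe_mk, AddHom.coe_mk, Sum.elim_inr]
    linear_combination (2 * v (Sum.inr j)) * inv_sqrt_two_mul_self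

theorem ext_plus_minus {v w : V ℝ} (h₁ : plus v = plus w) (h₂ : minus v = minus w) : v = w := by
  rw [← glue_plus_minus v, h₁, h₂, glue_plus_minus]

theorem bil_eq_sum {R : Type*} [CommRing R] (v w : V R) :
    bil v w = ∑ j, (v (Sum.inl j) * w (Sum.inr j) + v (Sum.inr j) * w (Sum.inl j)) := by
  simp [bil, J, dotProduct, Fintype.sum_sum_type, Matrix.fromBlocks_mulVec, Finset.sum_add_distrib]

theorem bil_eq (v w : V ℝ) :
    bil v w = inner ℝ (plus v) (plus w) - inner ℝ (minus v) (minus w) := by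
  rw [bil_eq_sum]
  simp only [PiLp.inner_apply, ← Finset.sum_sub_distrib]
  refine Finset.sum_congr rfl fun j _ => ?_
  simp only [plus, minus, LinearMap.coe_mk, AddHom.coe_mk, RCLike.inner_apply, conj_trivial]
  linear_combination (-2 * (v (Sum.inl j) * w (Sum.inr j) + v (Sum.inr j) * w (Sum.inl j))) *
    inv_sqrt_two_mul_self

theorem bil_comm {R : Type*} [CommRing R] (v w : V R) : bil v w = bil w v := by
  rw [bil_eq_sum, bil_eq_sum]
  exact Finset.sum_congr rfl fun j _ => by ring

theorem bil_add_left {R : Type*} [CommRing R] (u v w : V R) :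
    bil (u + v) w = bil u w + bil v w := add_dotProduct _ _ _

theorem bil_smul_left {R : Type*} [CommRing R] (a : R) (v w : V R) :
    bil (a • v) w = a * bil v w := smul_dotProduct _ _ _

theorem bil_add_right {R : Type*} [CommRing R] (u v w : V R) :
    bil u (v + w) = bil u v + bil u w := by
  rw [bil_comm, bil_add_left, bil_comm v, bil_comm w]

theorem bil_smul_right {R : Type*} [CommRing R] (a : R) (v w : V R) :
    bil v (a • w) = a * bil v w := by
  rw [bil_comm, bil_smul_left, bil_comm w]

/-- The square of the Euclidean norm on `V`. -/
noncomputable def energy (v : V ℝ) : ℝ := ‖plus v‖ ^ 2 + ‖minus v‖ ^ 2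

theorem energy_nonneg (v : V ℝ) : 0 ≤ energy v := by unfold energy; positivity

theorem energy_eq_sum (v : V ℝ) :
    energy v = ∑ j, (v (Sum.inl j) ^ 2 + v (Sum.inr j) ^ 2) := by
  simp only [energy, EuclideanSpace.norm_sq_eq, ← Finset.sum_add_distrib]
  refine Finset.sum_congr rfl fun j _ => ?_
  simp only [plus, minus, LinearMap.coe_mk, AddHom.coe_mk, Real.norm_eq_abs, sq_abs]
  linear_combination (2 * (v (Sum.inl j) ^ 2 + v (Sum.inr j) ^ 2)) * inv_sqrt_two_mul_self

theorem sq_apply_le_energy (v : V ℝ) (i : Idx) : v i ^ 2 ≤ energy v := by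
  rw [energy_eq_sum]
  rcases i with j | j
  · exact (le_add_of_nonneg_right (sq_nonneg _)).trans (Finset.single_le_sum
      (f := fun j => v (Sum.inl j) ^ 2 + v (Sum.inr j) ^ 2) (fun _ _ => by positivity)
      (Finset.mem_univ j))
  · exact (le_add_of_nonneg_left (sq_nonneg _)).trans (Finset.single_le_sum
      (f := fun j => v (Sum.inl j) ^ 2 + v (Sum.inr j) ^ 2) (fun _ _ => by positivity)
      (Finset.mem_univ j))

theorem energy_single (i : Idx) : energy (Pi.single i 1) = 1 := by
  rw [energy_eq_sum]
  rcases i with j | j <;> simp [Pi.single_apply]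

theorem bil_sq_le (u v : V ℝ) : bil u v ^ 2 ≤ energy u * energy v := by
  have h1 := abs_real_inner_le_norm (plus u) (plus v)
  have h2 := abs_real_inner_le_norm (minus u) (minus v)
  have h3 : |bil u v| ≤ ‖plus u‖ * ‖plus v‖ + ‖minus u‖ * ‖minus v‖ := by
    rw [bil_eq]; exact (abs_sub _ _).trans (add_le_add h1 h2)
  rw [← sq_abs]
  refine (pow_le_pow_left₀ (abs_nonneg _) h3 2).trans ?_
  unfold energy
  nlinarith [sq_nonneg (‖plus u‖ * ‖minus v‖ - ‖minus u‖ * ‖plus v‖)]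

/-! ### Isometries of the quadratic space -/

/-- Linear maps preserving the bilinear form. -/
def IsIsom (T : V ℝ →ₗ[ℝ] V ℝ) : Prop := ∀ v w, bil (T v) (T w) = bil v w

theorem IsIsom.comp {S T : V ℝ →ₗ[ℝ] V ℝ} (hS : IsIsom S) (hT : IsIsom T) : IsIsom (S ∘ₗ T) :=
  fun v w => (hS _ _).trans (hT v w)

theorem transpose_mul_J_mul_eq (A : Matrix Idx Idx ℝ) :
    A.transpose * J ℝ * A = J ℝ ↔ ∀ v w, bil (A.mulVec v) (A.mulVec w) = bil v w := by
  have key : ∀ v w, bil (A.mulVec v) (A.mulVec w) = v ⬝ᵥ (A.transpose * J ℝ * A).mulVec w := by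
    intro v w
    rw [bil, ← Matrix.mulVec_mulVec, ← Matrix.mulVec_mulVec, Matrix.dotProduct_mulVec v,
      Matrix.vecMul_transpose]
  constructor
  · intro h v w
    rw [key, h, bil]
  · intro h
    ext i j
    have := h (Pi.single i 1) (Pi.single j 1)
    rw [key, bil] at this
    simpa using this

theorem bil_mat_mulVec (g : G) (v w : V ℝ) :
    bil ((mat g).mulVec v) ((mat g).mulVec w) = bil v w :=
  (transpose_mul_J_mul_eq (mat g)).1 g.2 v w

theorem IsIsom.toMatrix {T : V ℝ →ₗ[ℝ] V ℝ} (hT : IsIsom T) :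
    (LinearMap.toMatrix' T).transpose * J ℝ * LinearMap.toMatrix' T = J ℝ := by
  rw [transpose_mul_J_mul_eq]
  intro v w
  rw [LinearMap.toMatrix'_mulVec, LinearMap.toMatrix'_mulVec, hT]

theorem J_mul_J : J ℝ * J ℝ = 1 := by
  simp [J, Matrix.fromBlocks_multiply, Matrix.fromBlocks_one]

theorem IsIsom.det {T : V ℝ →ₗ[ℝ] V ℝ} (hT : IsIsom T) :
    LinearMap.det T = 1 ∨ LinearMap.det T = -1 := by
  have h := congrArg Matrix.det hT.toMatrix
  have hJ : (J ℝ).det * (J ℝ).det = 1 := by rw [← Matrix.det_mul, J_mul_J, Matrix.det_one]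
  rw [Matrix.det_mul, Matrix.det_mul, Matrix.det_transpose, LinearMap.det_toMatrix'] at h
  rw [← mul_self_eq_one_iff]
  linear_combination (J ℝ).det * h + (1 - LinearMap.det T ^ 2) * hJ

theorem IsIsom.exists_group {T : V ℝ →ₗ[ℝ] V ℝ} (hT : IsIsom T) (hd : LinearMap.det T = 1) :
    ∃ g : G, ∀ v, (mat g).mulVec v = T v :=
  ⟨⟨⟨LinearMap.toMatrix' T, by rw [LinearMap.det_toMatrix', hd]⟩, hT.toMatrix⟩,
    fun v => LinearMap.toMatrix'_mulVec T v⟩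

/-- The reflection in a vector `u` with `(u, u) = -1`. -/
noncomputable def refl (u : V ℝ) : V ℝ →ₗ[ℝ] V ℝ where
  toFun v := v + (2 * bil u v) • u
  map_add' v w := by rw [bil_add_right]; module
  map_smul' a v := by rw [bil_smul_right, RingHom.id_apply]; module

theorem refl_apply (u v : V ℝ) : refl u v = v + (2 * bil u v) • u := rfl

theorem isIsom_refl {u : V ℝ} (hu : bil u u = -1) : IsIsom (refl u) := by
  intro v w
  simp only [refl_apply, bil_add_left, bil_add_right, bil_smul_left, bil_smul_right, hu,
    bil_comm v u]
  ring

/-- The reflection is a rank-one perturbation of the identity, so its determinant is `1 + 2 (u, u)`.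
-/
theorem det_refl {u : V ℝ} (hu : bil u u = -1) : LinearMap.det (refl u) = -1 := by
  have h : LinearMap.toMatrix' (refl u) =
      1 + Matrix.replicateCol Unit u * Matrix.replicateRow Unit ((2 : ℝ) • (J ℝ).mulVec u) := by
    apply Matrix.toLin'.injective
    rw [Matrix.toLin'_toMatrix']
    refine LinearMap.ext fun v => ?_
    rw [Matrix.toLin'_apply, Matrix.add_mulVec, Matrix.one_mulVec, ← Matrix.vecMulVec_eq,
      Matrix.vecMulVec_mulVec, refl_apply, smul_dotProduct, smul_eq_mul, dotProduct_comm,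
      ← bil, bil_comm v u, op_smul_eq_smul]
  rw [← LinearMap.det_toMatrix', h, Matrix.det_one_add_replicateCol_mul_replicateRow,
    smul_dotProduct, smul_eq_mul, dotProduct_comm, ← bil, hu]
  norm_num


/-! ### Areas of parallelograms and positive frames -/

/-- The area of the parallelogram spanned by two vectors. -/
noncomputable def area (x y : E) : ℝ := √(‖x‖ ^ 2 * ‖y‖ ^ 2 - inner ℝ x y ^ 2)

theorem gram_nonneg (x y : E) : 0 ≤ ‖x‖ ^ 2 * ‖y‖ ^ 2 - inner ℝ x y ^ 2 := by
  have h := pow_le_pow_left₀ (abs_nonneg _) (abs_real_inner_le_norm x y) 2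
  rw [sq_abs, mul_pow] at h
  linarith

theorem area_sq (x y : E) : area x y ^ 2 = ‖x‖ ^ 2 * ‖y‖ ^ 2 - inner ℝ x y ^ 2 :=
  Real.sq_sqrt (gram_nonneg x y)

theorem area_nonneg (x y : E) : 0 ≤ area x y := Real.sqrt_nonneg _

theorem area_le (x y : E) : area x y ≤ ‖x‖ * ‖y‖ := by
  refine abs_le_of_sq_le_sq' ?_ (by positivity) |>.2
  rw [area_sq, mul_pow]
  linarith [sq_nonneg (inner ℝ x y)]

theorem area_of_inner_eq_zero {x y : E} (h : inner ℝ x y = 0) : area x y = ‖x‖ * ‖y‖ := by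
  rw [area, h, ← mul_pow]
  simp [Real.sqrt_sq (mul_nonneg (norm_nonneg x) (norm_nonneg y))]

theorem area_linear_comb (a b c d : ℝ) (x y : E) :
    area (a • x + b • y) (c • x + d • y) = |a * d - b * c| * area x y := by
  rw [area, area, ← Real.sqrt_sq_eq_abs, ← Real.sqrt_mul (sq_nonneg _)]
  congr 1
  simp only [← real_inner_self_eq_norm_sq, inner_add_left, inner_add_right, real_inner_smul_left,
    real_inner_smul_right, real_inner_comm x y]
  ring

/-- A pair of vectors which is orthonormal for the bilinear form. -/
structure IsFrame (p q : V ℝ) : Prop where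
  left : bil p p = 1
  right : bil q q = 1
  orth : bil p q = 0

theorem IsFrame.map {p q : V ℝ} (h : IsFrame p q) {T : V ℝ →ₗ[ℝ] V ℝ} (hT : IsIsom T) :
    IsFrame (T p) (T q) :=
  ⟨(hT _ _).trans h.left, (hT _ _).trans h.right, (hT _ _).trans h.orth⟩

theorem IsFrame.mat_mulVec {p q : V ℝ} (h : IsFrame p q) (g : G) :
    IsFrame ((mat g).mulVec p) ((mat g).mulVec q) :=
  ⟨(bil_mat_mulVec g _ _).trans h.left, (bil_mat_mulVec g _ _).trans h.right,
    (bil_mat_mulVec g _ _).trans h.orth⟩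

theorem norm_plus_sq {p : V ℝ} (h : bil p p = 1) : ‖plus p‖ ^ 2 = 1 + ‖minus p‖ ^ 2 := by
  rw [bil_eq, real_inner_self_eq_norm_sq, real_inner_self_eq_norm_sq] at h
  linarith

theorem one_le_norm_plus {p : V ℝ} (h : bil p p = 1) : 1 ≤ ‖plus p‖ := by
  have := norm_plus_sq h
  nlinarith [sq_nonneg ‖minus p‖, norm_nonneg (plus p)]

theorem norm_minus_le {p : V ℝ} (h : bil p p = 1) : ‖minus p‖ ≤ ‖plus p‖ := by
  have := norm_plus_sq h
  exact abs_le_of_sq_le_sq' (by linarith) (norm_nonneg _) |>.2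

theorem IsFrame.inner_minus {p q : V ℝ} (h : IsFrame p q) :
    inner ℝ (minus p) (minus q) = inner ℝ (plus p) (plus q) := by
  have := h.orth
  rw [bil_eq] at this
  linarith

theorem IsFrame.rotate {p q : V ℝ} (h : IsFrame p q) {a b : ℝ} (hab : a ^ 2 + b ^ 2 = 1) :
    IsFrame (a • p + b • q) ((-b) • p + a • q) := by
  have h3 := h.orth
  have h4 := bil_comm q p
  constructor <;> simp only [bil_add_left, bil_add_right, bil_smul_left, bil_smul_right,
    h.left, h.right, h3, h4]
  · linear_combination hab
  · linear_combination hab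
  · ring

/-- Every frame can be rotated, inside the plane it spans, to one with orthogonal components in
`V⁺` (and hence in `V⁻`). -/
theorem IsFrame.exists_rotation {p q : V ℝ} (h : IsFrame p q) :
    ∃ a b : ℝ, a ^ 2 + b ^ 2 = 1 ∧ IsFrame (a • p + b • q) ((-b) • p + a • q) ∧
      inner ℝ (plus (a • p + b • q)) (plus ((-b) • p + a • q)) = 0 ∧
      ‖plus ((-b) • p + a • q)‖ ≤ ‖plus (a • p + b • q)‖ := by
  have key : ∃ a b : ℝ, a ^ 2 + b ^ 2 = 1 ∧
      inner ℝ (plus (a • p + b • q)) (plus ((-b) • p + a • q)) = 0 := by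
    -- Rotating the pair by an angle `θ` rotates `z` by `-2θ`; half the argument of `z` therefore
    -- makes it real, which diagonalizes the Gram matrix of the `V⁺`-components.
    let z : ℂ := ⟨(inner ℝ (plus p) (plus p) - inner ℝ (plus q) (plus q)) / 2,
      inner ℝ (plus p) (plus q)⟩
    have h1 : ‖z‖ * Real.cos z.arg = z.re := Complex.norm_mul_cos_arg z
    have h2 : ‖z‖ * Real.sin z.arg = z.im := Complex.norm_mul_sin_arg z
    rw [show z.arg = 2 * (z.arg / 2) by ring, Real.cos_two_mul'] at h1
    rw [show z.arg = 2 * (z.arg / 2) by ring, Real.sin_two_mul] at h2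
    refine ⟨Real.cos (z.arg / 2), Real.sin (z.arg / 2), Real.cos_sq_add_sin_sq _, ?_⟩
    simp only [map_add, map_smul, inner_add_left, inner_add_right, real_inner_smul_left,
      real_inner_smul_right, real_inner_comm (plus p) (plus q)]
    set a := Real.cos (z.arg / 2)
    set b := Real.sin (z.arg / 2)
    simp only [z] at h1 h2
    linear_combination 2 * a * b * h1 - (a ^ 2 - b ^ 2) * h2
  obtain ⟨a, b, hab, h0⟩ := key
  rcases le_total ‖plus ((-b) • p + a • q)‖ ‖plus (a • p + b • q)‖ with hle | hle
  · exact ⟨a, b, hab, h.rotate hab, h0, hle⟩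
  -- A further quarter turn exchanges the two vectors up to sign.
  · have hab' : (-b) ^ 2 + a ^ 2 = 1 := by linarith
    have e : (-a) • p + (-b) • q = -(a • p + b • q) := by module
    refine ⟨-b, a, hab', h.rotate hab', ?_, ?_⟩
    · rw [e, map_neg, inner_neg_right, real_inner_comm, h0, neg_zero]
    · rwa [e, map_neg, norm_neg]

theorem area_rotate (T : V ℝ →ₗ[ℝ] E) {a b : ℝ} (hab : a ^ 2 + b ^ 2 = 1) (p q : V ℝ) :
    area (T (a • p + b • q)) (T ((-b) • p + a • q)) = area (T p) (T q) := by
  rw [map_add, map_add, map_smul, map_smul, map_smul, map_smul, area_linear_comb,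
    show a * a - b * -b = 1 by linarith, abs_one, one_mul]

/-! ### Contracting reflections -/

/-- The defect from `1` is quadratic in the distance, which is what lets a coarse net survive
multiplication by the large boost coefficients. -/
theorem inner_eq_of_norm_eq_one {x y : E} (hx : ‖x‖ = 1) (hy : ‖y‖ = 1) :
    inner ℝ x y = 1 - ‖x - y‖ ^ 2 / 2 := by
  rw [norm_sub_sq_real, hx, hy]; ring

/-- A vector of square `-1`, whose reflection, composed with a reflection of `V⁻`, is the
hyperbolic rotation with factor `1024` in the plane spanned by `x ∈ V⁺` and `y ∈ V⁻`. -/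
noncomputable def boostAxis (x y : E) : V ℝ := glue ((1023 / 64 : ℝ) • x) ((1025 / 64 : ℝ) • y)

theorem bil_boostAxis (x y : E) (v : V ℝ) :
    bil (boostAxis x y) v =
      1023 / 64 * inner ℝ x (plus v) - 1025 / 64 * inner ℝ y (minus v) := by
  simp [bil_eq, boostAxis, real_inner_smul_left]

/-- The coefficients are `sinh (log 32)` and `cosh (log 32)`; the resulting reflection sends the
isotropic vector `x + y` to `(x - y) / 1024`. -/
theorem bil_boostAxis_self {x y : E} (hx : ‖x‖ = 1) (hy : ‖y‖ = 1) :
    bil (boostAxis x y) (boostAxis x y) = -1 := by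
  simp [bil_eq, boostAxis, hx, hy, norm_smul]
  norm_num

theorem plus_refl_boostAxis (x y : E) (v : V ℝ) :
    plus (refl (boostAxis x y) v) = plus v +
      (1023 / 32 * (1023 / 64 * inner ℝ x (plus v) - 1025 / 64 * inner ℝ y (minus v))) • x := by
  rw [refl_apply, bil_boostAxis, map_add, map_smul, boostAxis, plus_glue, smul_smul]
  congr 2
  ring

/-- A long vector of square `1` is close to a multiple of the isotropic vector `e + f`. The exact
factor 1024 degrades to 256 because `x`, `y` only approximate `e`, `f` and `s` only approximates
`α`. -/
theorem norm_plus_refl_left_le {p : V ℝ} {e f x y : E} {α s : ℝ} (hα : 1024 ≤ α) (hs : 0 ≤ s)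
    (hαs : α ^ 2 = 1 + s ^ 2) (hp : plus p = α • e) (hm : minus p = s • f)
    (he : ‖e‖ = 1) (hf : ‖f‖ = 1) (hx : ‖x‖ = 1) (hy : ‖y‖ = 1)
    (hex : ‖x - e‖ ≤ 1 / 1024) (hfy : ‖y - f‖ ≤ 1 / 1024) :
    ‖plus (refl (boostAxis x y) p)‖ ≤ α / 256 := by
  rw [plus_refl_boostAxis, hp, hm, real_inner_smul_right, real_inner_smul_right,
    inner_eq_of_norm_eq_one hx he, inner_eq_of_norm_eq_one hy hf]
  have hsq : ∀ t : ℝ, 0 ≤ t → t ≤ 1 / 1024 → t ^ 2 / 2 ≤ 1 / 2097152 := fun t h0 h1 => by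
    nlinarith
  have d1 := hsq _ (norm_nonneg _) hex
  have d2 := hsq _ (norm_nonneg _) hfy
  have n1 : 0 ≤ ‖x - e‖ ^ 2 / 2 := by positivity
  have n2 : 0 ≤ ‖y - f‖ ^ 2 / 2 := by positivity
  set δ := ‖x - e‖ ^ 2 / 2
  set η := ‖y - f‖ ^ 2 / 2
  set k := 1023 / 32 * (1023 / 64 * (α * (1 - δ)) - 1025 / 64 * (s * (1 - η)))
  have hsα : s ≤ α := by nlinarith
  have hdiff : α - s ≤ 1 / 1024 := by
    have h1 : (α - s) * (α + s) = 1 := by linarith [hαs, sq α, sq s]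
    nlinarith
  -- Since `k` is nearly `-α`, both summands on the right are small compared with `α`.
  have e1 : α • e + k • x = (-α) • (x - e) + (k + α) • x := by module
  have m1 : 0 ≤ α * δ := by positivity
  have m2 : α * δ ≤ α * (1 / 2097152) := by gcongr
  have m3 : 0 ≤ s * η := by positivity
  have m4 : s * η ≤ α * (1 / 2097152) := by gcongr
  have hk : |k + α| ≤ 3 * α / 1024 := by
    have e2 : k + α = (1 + 1023 * 1023 / 2048) * (α - s) + s / 1024
        - 1023 * 1023 / 2048 * (α * δ) + 1023 * 1025 / 2048 * (s * η) := by
      simp only [k]; ring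
    rw [e2, abs_le]
    constructor <;> linarith
  rw [e1]
  calc _ ≤ ‖(-α) • (x - e)‖ + ‖(k + α) • x‖ := norm_add_le _ _
    _ = α * ‖x - e‖ + |k + α| := by
      rw [norm_smul, norm_smul, hx, mul_one, norm_neg, Real.norm_eq_abs, Real.norm_eq_abs,
        abs_of_nonneg (by linarith : (0 : ℝ) ≤ α)]
    _ ≤ α * (1 / 1024) + 3 * α / 1024 := by gcongr
    _ = α / 256 := by ring

/-- The companion vector is orthogonal to `e` and `f`, hence almost orthogonal to `x` and `y`; its
pairing with the axis is small enough that the reflection at most doubles its `V⁺`-part. -/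
theorem norm_plus_refl_right_le {q : V ℝ} {e f x y : E} (hq : bil q q = 1)
    (hp : inner ℝ e (plus q) = 0) (hm : inner ℝ f (minus q) = 0) (hx : ‖x‖ = 1)
    (hex : ‖x - e‖ ≤ 1 / 1024) (hfy : ‖y - f‖ ≤ 1 / 1024) :
    ‖plus (refl (boostAxis x y) q)‖ ≤ 2 * ‖plus q‖ := by
  rw [plus_refl_boostAxis]
  have h1 : |inner ℝ x (plus q)| ≤ 1 / 1024 * ‖plus q‖ := by
    rw [← sub_zero (inner ℝ x (plus q)), ← hp, ← inner_sub_left]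
    exact (abs_real_inner_le_norm _ _).trans (by gcongr)
  have h2 : |inner ℝ y (minus q)| ≤ 1 / 1024 * ‖plus q‖ := by
    rw [← sub_zero (inner ℝ y (minus q)), ← hm, ← inner_sub_left]
    exact (abs_real_inner_le_norm _ _).trans
      (mul_le_mul hfy (norm_minus_le hq) (norm_nonneg _) (by norm_num))
  refine (norm_add_le _ _).trans ?_
  rw [norm_smul, hx, mul_one, Real.norm_eq_abs]
  have h3 : |1023 / 32 * (1023 / 64 * inner ℝ x (plus q) - 1025 / 64 * inner ℝ y (minus q))|
      ≤ ‖plus q‖ := by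
    rw [abs_le] at h1 h2 ⊢
    constructor <;> linarith [norm_nonneg (plus q)]
  linarith

/-! ### A finite net of directions -/

/-- The label of a cell of side `1 / 2048` in `ℝ⁴`. -/
noncomputable def cell (x : E) : Fin 4 → ℤ := fun j => ⌊2048 * x j⌋

/-- A four-dimensional cube has diagonal twice its side. -/
theorem norm_sub_le_of_cell_eq {x y : E} (h : cell x = cell y) : ‖x - y‖ ≤ 1 / 1024 := by
  refine abs_le_of_sq_le_sq' ?_ (by norm_num) |>.2
  rw [EuclideanSpace.norm_sq_eq]
  have hj : ∀ j, ‖(x - y) j‖ ^ 2 ≤ 1 / 2048 ^ 2 := by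
    intro j
    have h1 := Int.abs_sub_lt_one_of_floor_eq_floor (congrFun h j)
    rw [← mul_sub, abs_mul, abs_of_pos (by norm_num : (0 : ℝ) < 2048)] at h1
    rw [PiLp.sub_apply, Real.norm_eq_abs]
    have h2 : |x j - y j| ≤ 1 / 2048 := by linarith
    calc _ ≤ (1 / 2048 : ℝ) ^ 2 := by gcongr
      _ = _ := by norm_num
  refine (Finset.sum_le_sum fun j _ => hj j).trans ?_
  simp
  norm_num

/-- The labels of the cells with coordinates bounded by `N`. -/
noncomputable def cells (N : ℤ) : Finset (Fin 4 → ℤ) := Fintype.piFinset fun _ => Finset.Icc (-N) N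

theorem cell_mem_cells {N : ℤ} (hN : N = 2048) {x : E} (hx : ‖x‖ = 1) : cell x ∈ cells N := by
  rw [cells, Fintype.mem_piFinset]
  intro j
  have h := (PiLp.norm_apply_le x j).trans hx.le
  rw [Real.norm_eq_abs, abs_le] at h
  rw [Finset.mem_Icc]
  constructor
  · refine Int.le_floor.2 ?_
    rw [hN]
    push_cast
    linarith
  · have : ((cell x j : ℤ) : ℝ) ≤ 2048 := (Int.floor_le _).trans (by linarith)
    rw [hN]
    exact_mod_cast this

theorem card_cells {N : ℤ} (hN : N = 2048) : (cells N).card = 4097 ^ 4 := by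
  rw [cells, Fintype.card_piFinset]
  simp [hN]

/-- A reflection has determinant `-1`; following it with a reflection in a vector of `V⁻` restores
determinant `1` and leaves the `V⁺`-components untouched. -/
theorem exists_group_refl {u : V ℝ} (hu : bil u u = -1) :
    ∃ g : G, ∀ v, plus ((mat g).mulVec v) = plus (refl u v) := by
  let w : V ℝ := glue 0 (EuclideanSpace.single 0 1)
  have hw : bil w w = -1 := by simp [bil_eq, w]
  obtain ⟨g, hg⟩ := ((isIsom_refl hw).comp (isIsom_refl hu)).exists_group (by
    rw [LinearMap.det_comp, det_refl hu, det_refl hw]; norm_num)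
  refine ⟨g, fun v => ?_⟩
  rw [hg, LinearMap.comp_apply, refl_apply w, map_add, map_smul]
  simp [w]

/-- After rotation the area is the product of the two `V⁺`-lengths; one reflection divides the
larger by 256 and at most doubles the other. The reflection depends only on the cells of the two
directions of the longer vector. -/
theorem exists_contracting : ∃ (I : Finset ((Fin 4 → ℤ) × (Fin 4 → ℤ)))
    (γ : (Fin 4 → ℤ) × (Fin 4 → ℤ) → G), I.card = 4097 ^ 8 ∧ ∀ p q, IsFrame p q →
    2 ^ 20 ≤ area (plus p) (plus q) → ∃ i ∈ I,
      area (plus ((mat (γ i)).mulVec p)) (plus ((mat (γ i)).mulVec q)) ≤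
        area (plus p) (plus q) / 128 := by
  have hγ : ∀ i : (Fin 4 → ℤ) × (Fin 4 → ℤ), ∃ g : G, ∀ e f : E, ‖e‖ = 1 → ‖f‖ = 1 →
      cell e = i.1 → cell f = i.2 → ∃ x y : E, ‖x‖ = 1 ∧ ‖y‖ = 1 ∧ ‖x - e‖ ≤ 1 / 1024 ∧
        ‖y - f‖ ≤ 1 / 1024 ∧
        ∀ v, plus ((mat g).mulVec v) = plus (refl (boostAxis x y) v) := by
    intro i
    by_cases hi : ∃ x y : E, ‖x‖ = 1 ∧ ‖y‖ = 1 ∧ cell x = i.1 ∧ cell y = i.2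
    · obtain ⟨x, y, hx, hy, hx', hy'⟩ := hi
      obtain ⟨g, hg⟩ := exists_group_refl (bil_boostAxis_self hx hy)
      exact ⟨g, fun e f _ _ he hf => ⟨x, y, hx, hy, norm_sub_le_of_cell_eq (hx'.trans he.symm),
        norm_sub_le_of_cell_eq (hy'.trans hf.symm), hg⟩⟩
    -- No pair of unit vectors has these labels, so any group element will do.
    · exact ⟨1, fun e f he hf he' hf' => (hi ⟨e, f, he, hf, he', hf'⟩).elim⟩
  choose γ hγ using hγ
  obtain ⟨N, hN⟩ : ∃ N : ℤ, N = 2048 := ⟨_, rfl⟩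
  refine ⟨cells N ×ˢ cells N, γ, ?_, fun p₀ q₀ h₀ hA => ?_⟩
  · rw [Finset.card_product, card_cells hN, ← pow_add]
  obtain ⟨a, b, hab, h, h0, hle⟩ := h₀.exists_rotation
  have hrot : ∀ g : G, area (plus ((mat g).mulVec p₀)) (plus ((mat g).mulVec q₀)) =
      area (plus ((mat g).mulVec (a • p₀ + b • q₀)))
        (plus ((mat g).mulVec ((-b) • p₀ + a • q₀))) := fun g =>
    (area_rotate (plus ∘ₗ (mat g).mulVecLin) hab p₀ q₀).symm
  rw [← area_rotate plus hab] at hA ⊢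
  simp only [hrot]
  generalize a • p₀ + b • q₀ = p at *
  generalize (-b) • p₀ + a • q₀ = q at *
  rw [area_of_inner_eq_zero h0] at hA ⊢
  -- The larger of two factors with product at least `2 ^ 20` is at least `2 ^ 10`.
  have hα : 1024 ≤ ‖plus p‖ := by nlinarith [norm_nonneg (plus p), norm_nonneg (plus q)]
  have hαs := norm_plus_sq h.left
  have hs : 0 < ‖minus p‖ := by
    refine lt_of_le_of_ne (norm_nonneg _) fun h' => ?_
    rw [← h'] at hαs
    nlinarith
  have hα0 : 0 < ‖plus p‖ := by linarith
  have he : ‖‖plus p‖⁻¹ • plus p‖ = 1 := norm_smul_inv_norm (norm_pos_iff.1 hα0)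
  have hf : ‖‖minus p‖⁻¹ • minus p‖ = 1 := norm_smul_inv_norm (norm_pos_iff.1 hs)
  obtain ⟨x, y, hx, hy, hxe, hyf, hg⟩ := hγ (cell (‖plus p‖⁻¹ • plus p),
    cell (‖minus p‖⁻¹ • minus p)) _ _ he hf rfl rfl
  have m1 := cell_mem_cells hN he
  have m2 := cell_mem_cells hN hf
  refine ⟨(cell (‖plus p‖⁻¹ • plus p), cell (‖minus p‖⁻¹ • minus p)),
    ?_, ?_⟩
  · exact Finset.mk_mem_product m1 m2
  rw [hg, hg]
  refine (area_le _ _).trans ?_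
  have h1 := norm_plus_refl_left_le hα hs.le hαs (smul_inv_smul₀ hα0.ne' _).symm
    (smul_inv_smul₀ hs.ne' _).symm he hf hx hy hxe hyf
  have h2 := norm_plus_refl_right_le h.right (by rw [real_inner_smul_left, h0, mul_zero])
    (by rw [real_inner_smul_left, h.inner_minus, h0, mul_zero]) hx hxe hyf
  calc _ ≤ ‖plus p‖ / 256 * (2 * ‖plus q‖) := by gcongr
    _ = _ := by ring


/-! ### Moving frames into `V⁺` by bounded isometries -/

theorem energy_add_le (v w : V ℝ) : energy (v + w) ≤ 2 * energy v + 2 * energy w := by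
  have key : ∀ x y : E, ‖x + y‖ ^ 2 ≤ 2 * ‖x‖ ^ 2 + 2 * ‖y‖ ^ 2 := fun x y => by
    have := parallelogram_law_with_norm ℝ x y
    nlinarith [sq_nonneg ‖x - y‖]
  simp only [energy, map_add]
  linarith [key (plus v) (plus w), key (minus v) (minus w)]

theorem energy_smul (a : ℝ) (v : V ℝ) : energy (a • v) = a ^ 2 * energy v := by
  simp [energy, norm_smul, mul_pow]; ring

theorem energy_refl_le {u : V ℝ} {R : ℝ} (hR : energy u ≤ R) (v : V ℝ) :
    energy (refl u v) ≤ (2 + 8 * R ^ 2) * energy v := by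
  have h0 := energy_nonneg u
  have hR0 := h0.trans hR
  have hv := energy_nonneg v
  refine (energy_add_le _ _).trans ?_
  rw [energy_smul]
  have h1 : bil u v ^ 2 * energy u ≤ R * energy v * R := by
    refine mul_le_mul ((bil_sq_le u v).trans ?_) hR h0 (by positivity)
    gcongr
  nlinarith

/-- The map is the reflection exchanging `p` with the normalization `e` of its `V⁺`-part. The last
clause lets a second such reflection act without disturbing the first. -/
theorem exists_isIsom_minus_eq_zero {p : V ℝ} (hp : bil p p = 1) {R : ℝ} (hR : ‖plus p‖ ≤ R) :
    ∃ T : V ℝ →ₗ[ℝ] V ℝ, IsIsom T ∧ (∀ v, energy (T v) ≤ (2 + 8 * R ^ 2) * energy v) ∧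
      minus (T p) = 0 ∧ plus (T p) = ‖plus p‖⁻¹ • plus p ∧
      ∀ v, inner ℝ (plus p) (plus v) = 0 → inner ℝ (minus p) (minus v) = 0 → T v = v := by
  have h1 := one_le_norm_plus hp
  have hs := norm_plus_sq hp
  set α := ‖plus p‖ with hα
  rcases h1.eq_or_lt with h1 | h1
  · refine ⟨LinearMap.id, fun _ _ => rfl, fun v => ?_, ?_, ?_, fun _ _ _ => rfl⟩
    · rw [LinearMap.id_apply]
      nlinarith [energy_nonneg v, mul_nonneg (sq_nonneg R) (energy_nonneg v)]
    · rw [← h1] at hs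
      rw [LinearMap.id_apply]
      exact norm_eq_zero.1 (pow_eq_zero_iff two_ne_zero |>.1 (by linarith))
    · rw [← h1]; simp
  · have hα0 : α ≠ 0 := by linarith
    set e : V ℝ := glue (α⁻¹ • plus p) 0 with he
    have hee : bil e e = 1 := by
      rw [bil_eq, he, plus_glue, minus_glue, real_inner_self_eq_norm_sq, norm_smul, norm_inv,
        norm_norm, ← hα, inv_mul_cancel₀ hα0]
      simp
    have hpe : bil p e = α := by
      rw [bil_eq, he, plus_glue, minus_glue, real_inner_smul_right, real_inner_self_eq_norm_sq,
        inner_zero_right, ← hα]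
      field_simp
      ring
    -- Normalizes `p - e`, whose square is `-2 (α - 1)`.
    set r : ℝ := (√(2 * (α - 1)))⁻¹
    have hr : r ^ 2 * (2 * (α - 1)) = 1 := by
      rw [inv_pow, Real.sq_sqrt (by linarith)]
      exact inv_mul_cancel₀ (by linarith)
    have hbil : ∀ v, bil (r • (p - e)) v = r * (bil p v - bil e v) := fun v => by
      rw [bil_smul_left, sub_eq_add_neg, bil_add_left, ← neg_one_smul ℝ e, bil_smul_left]; ring
    have huu : bil (r • (p - e)) (r • (p - e)) = -1 := by
      rw [hbil, bil_comm p, bil_comm e, hbil, hbil, bil_comm e p, hp, hpe, hee]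
      linear_combination -hr
    have hTp : refl (r • (p - e)) p = e := by
      rw [refl_apply, hbil, bil_comm e p, hp, hpe, smul_smul,
        show 2 * (r * (1 - α)) * r = -1 by linear_combination -hr]
      module
    -- The factor `α - 1` cancels, so the bound stays uniform as `p` approaches `V⁺`.
    have hen : energy (r • (p - e)) = α := by
      rw [energy_smul, energy, map_sub, map_sub, he, plus_glue, minus_glue, sub_zero,
        show plus p - α⁻¹ • plus p = (1 - α⁻¹) • plus p by module, norm_smul, mul_pow,
        Real.norm_eq_abs, sq_abs, ← hα, show ‖minus p‖ ^ 2 = α ^ 2 - 1 by linarith]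
      have : (1 - α⁻¹) ^ 2 * α ^ 2 = (α - 1) ^ 2 := by field_simp
      rw [this]
      linear_combination α * hr
    refine ⟨refl (r • (p - e)), isIsom_refl huu, energy_refl_le (hen.trans_le hR), ?_, ?_,
      fun v h2 h3 => ?_⟩
    · rw [hTp, he, minus_glue]
    · rw [hTp, he, plus_glue]
    · rw [refl_apply, hbil, bil_eq, bil_eq, he, plus_glue, minus_glue, real_inner_smul_left, h2, h3]
      simp

theorem IsFrame.exists_isIsom_minus_eq_zero {p q : V ℝ} (h : IsFrame p q) {R : ℝ}
    (hR : area (plus p) (plus q) ≤ R) :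
    ∃ T : V ℝ →ₗ[ℝ] V ℝ, IsIsom T ∧ (∀ v, energy (T v) ≤ (2 + 8 * R ^ 2) ^ 2 * energy v) ∧
      minus (T p) = 0 ∧ minus (T q) = 0 := by
  obtain ⟨a, b, hab, h', h0, -⟩ := h.exists_rotation
  rw [← area_rotate plus hab, area_of_inner_eq_zero h0] at hR
  have hP : p = a • (a • p + b • q) + (-b) • ((-b) • p + a • q) := by
    have : p = (a ^ 2 + b ^ 2) • p := by rw [hab, one_smul]
    nth_rewrite 1 [this]; module
  have hQ : q = b • (a • p + b • q) + a • ((-b) • p + a • q) := by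
    have : q = (a ^ 2 + b ^ 2) • q := by rw [hab, one_smul]
    nth_rewrite 1 [this]; module
  have p1 := one_le_norm_plus h'.left
  have q1 := one_le_norm_plus h'.right
  have hi := h'.inner_minus
  generalize a • p + b • q = p' at *
  generalize (-b) • p + a • q = q' at *
  -- Both `V⁺`-lengths are at least `1` and their product is at most `R`, so each is at most `R`.
  obtain ⟨S, hS, hSe, hSm, hSp, hSf⟩ :=
    SplitSO8.exists_isIsom_minus_eq_zero h'.left (R := R) (by nlinarith)
  obtain ⟨T, hT, hTe, hTm, hTp, hTf⟩ :=
    SplitSO8.exists_isIsom_minus_eq_zero h'.right (R := R) (by nlinarith)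
  have hq : S q' = q' := hSf q' h0 (by rw [hi, h0])
  have hp : T (S p') = S p' := hTf _
    (by rw [hSp, real_inner_smul_right, real_inner_comm, h0, mul_zero])
    (by rw [hSm, inner_zero_right])
  refine ⟨T ∘ₗ S, hT.comp hS, fun v => ?_, ?_, ?_⟩
  · calc _ ≤ (2 + 8 * R ^ 2) * energy (S v) := hTe _
      _ ≤ (2 + 8 * R ^ 2) * ((2 + 8 * R ^ 2) * energy v) := by gcongr; exact hSe v
      _ = _ := by ring
  · simp only [hP, LinearMap.comp_apply, map_add, map_smul, hq, hp, hSm, hTm, smul_zero, add_zero]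
  · simp only [hQ, LinearMap.comp_apply, map_add, map_smul, hq, hp, hSm, hTm, smul_zero, add_zero]

theorem exists_linearIsometryEquiv {x y x' y' : E} (hx : ‖x‖ = 1) (hy : ‖y‖ = 1)
    (hxy : inner ℝ x y = 0) (hx' : ‖x'‖ = 1) (hy' : ‖y'‖ = 1) (hxy' : inner ℝ x' y' = 0) :
    ∃ L : E ≃ₗᵢ[ℝ] E, L x = x' ∧ L y = y' := by
  have key : ∀ x y : E, ‖x‖ = 1 → ‖y‖ = 1 → inner ℝ x y = 0 →
      ∃ b : OrthonormalBasis (Fin 4) ℝ E, b 0 = x ∧ b 1 = y := by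
    intro x y hx hy hxy
    have ho : Orthonormal ℝ (Set.domRestrict ({0, 1} : Set (Fin 4)) ![x, y, 0, 0]) := by
      constructor
      · rintro ⟨i, rfl | rfl⟩ <;> simpa
      · rintro ⟨i, rfl | rfl⟩ ⟨j, rfl | rfl⟩ hij
        · exact (hij rfl).elim
        · exact hxy
        · exact (real_inner_comm x y).trans hxy
        · exact (hij rfl).elim
    obtain ⟨b, hb⟩ := ho.exists_orthonormalBasis_extension_of_card_eq (by simp)
    exact ⟨b, hb 0 (by simp), hb 1 (by simp)⟩
  obtain ⟨b, rfl, rfl⟩ := key x y hx hy hxy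
  obtain ⟨b', rfl, rfl⟩ := key x' y' hx' hy' hxy'
  exact ⟨b.equiv b' (Equiv.refl _), by simp, by simp⟩

/-- The action of an orthogonal transformation of `V⁺` on `V`. -/
noncomputable def extendPlus (L : E ≃ₗᵢ[ℝ] E) : V ℝ →ₗ[ℝ] V ℝ where
  toFun v := glue (L (plus v)) (minus v)
  map_add' v w := ext_plus_minus (by simp) (by simp)
  map_smul' a v := ext_plus_minus (by simp) (by simp)

theorem extendPlus_apply (L : E ≃ₗᵢ[ℝ] E) (v : V ℝ) :
    extendPlus L v = glue (L (plus v)) (minus v) := rfl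

theorem isIsom_extendPlus (L : E ≃ₗᵢ[ℝ] E) : IsIsom (extendPlus L) := fun v w => by
  simp [bil_eq, extendPlus_apply]

theorem energy_extendPlus (L : E ≃ₗᵢ[ℝ] E) (v : V ℝ) : energy (extendPlus L v) = energy v := by
  simp [energy, extendPlus_apply]

theorem exists_energy_le (T : V ℝ →ₗ[ℝ] V ℝ) : ∃ C, 0 ≤ C ∧ ∀ v, energy (T v) ≤ C * energy v := by
  have h1 : ∀ v, ‖v‖ ^ 2 ≤ energy v := fun v => by
    have : ‖v‖ ≤ √(energy v) := (pi_norm_le_iff_of_nonneg (Real.sqrt_nonneg _)).2 fun i =>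
      Real.abs_le_sqrt (sq_apply_le_energy v i)
    calc _ ≤ √(energy v) ^ 2 := by gcongr
      _ = _ := Real.sq_sqrt (energy_nonneg v)
  have h2 : ∀ v, energy v ≤ 8 * ‖v‖ ^ 2 := fun v => by
    have hi : ∀ i, v i ^ 2 ≤ ‖v‖ ^ 2 := fun i => by
      rw [← sq_abs]
      exact pow_le_pow_left₀ (abs_nonneg _) (norm_le_pi_norm v i) 2
    rw [energy_eq_sum]
    calc _ ≤ ∑ _ : Fin 4, (‖v‖ ^ 2 + ‖v‖ ^ 2) :=
          Finset.sum_le_sum fun j _ => add_le_add (hi _) (hi _)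
      _ = _ := by simp; ring
  set N := ‖LinearMap.toContinuousLinearMap T‖
  refine ⟨8 * N ^ 2, by positivity, fun v => (h2 _).trans ?_⟩
  have h3 : ‖T v‖ ≤ N * ‖v‖ := (LinearMap.toContinuousLinearMap T).le_opNorm v
  calc 8 * ‖T v‖ ^ 2 ≤ 8 * (N * ‖v‖) ^ 2 := by gcongr
    _ = 8 * N ^ 2 * ‖v‖ ^ 2 := by ring
    _ ≤ _ := by gcongr; exact h1 v

/-- Frames of bounded area are moved to a given frame by bounded elements of the group. -/
theorem IsFrame.exists_bounded_group {p₀ q₀ : V ℝ} (h₀ : IsFrame p₀ q₀) (R : ℝ) :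
    ∃ C, ∀ p q, IsFrame p q → area (plus p) (plus q) ≤ R → ∃ g : G,
      (∀ v, energy ((mat g).mulVec v) ≤ C * energy v) ∧
        (mat g).mulVec p = p₀ ∧ (mat g).mulVec q = q₀ := by
  obtain ⟨T₀, hT₀, -, hp₀, hq₀⟩ := h₀.exists_isIsom_minus_eq_zero le_rfl
  have hdet : LinearMap.det T₀ ≠ 0 := by rcases hT₀.det with h | h <;> rw [h] <;> norm_num
  let U := LinearMap.equivOfDetNeZero T₀ hdet
  have hU : ∀ v, U v = T₀ v := fun v => rfl
  have hUs : IsIsom (U.symm : V ℝ →ₗ[ℝ] V ℝ) := fun v w => by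
    rw [← hT₀, ← hU, ← hU]; simp
  -- Reflection in `w` fixes `V⁺` pointwise and is inserted when the determinant comes out as `-1`.
  let w : V ℝ := glue 0 (EuclideanSpace.single 0 1)
  have hw : bil w w = -1 := by simp [bil_eq, w]
  have hfix : ∀ v, minus v = 0 → refl w v = v := fun v hv => by
    simp [refl_apply, bil_eq, w, hv]
  obtain ⟨A, hA0, hA⟩ := exists_energy_le (U.symm : V ℝ →ₗ[ℝ] V ℝ)
  obtain ⟨B, hB0, hB⟩ := exists_energy_le (refl w)
  -- The factor `1 + B` covers both cases, with and without the correcting reflection.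
  refine ⟨A * ((1 + B) * (2 + 8 * R ^ 2) ^ 2), fun p q h hR => ?_⟩
  obtain ⟨T, hT, hTe, hTp, hTq⟩ := h.exists_isIsom_minus_eq_zero hR
  have norm_one : ∀ v : V ℝ, bil v v = 1 → minus v = 0 → ‖plus v‖ = 1 := fun v h1 h2 => by
    have := norm_plus_sq h1
    rw [h2, norm_zero] at this
    exact (pow_eq_one_iff_of_nonneg (norm_nonneg _) two_ne_zero).1 (by linarith)
  have inner_zero : ∀ v w : V ℝ, IsFrame v w → minus v = 0 → inner ℝ (plus v) (plus w) = 0 :=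
    fun v w h1 h2 => by rw [← h1.inner_minus, h2, inner_zero_left]
  have f := h.map hT
  have f₀ := h₀.map hT₀
  obtain ⟨L, hLp, hLq⟩ := exists_linearIsometryEquiv (norm_one _ f.left hTp)
    (norm_one _ f.right hTq) (inner_zero _ _ f hTp) (norm_one _ f₀.left hp₀)
    (norm_one _ f₀.right hq₀) (inner_zero _ _ f₀ hp₀)
  have hp : extendPlus L (T p) = T₀ p₀ :=
    ext_plus_minus (by simp [extendPlus_apply, hLp]) (by simp [extendPlus_apply, hTp, hp₀])
  have hq : extendPlus L (T q) = T₀ q₀ :=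
    ext_plus_minus (by simp [extendPlus_apply, hLq]) (by simp [extendPlus_apply, hTq, hq₀])
  have bound : ∀ x v : V ℝ, energy x ≤ (1 + B) * energy (T v) →
      energy (U.symm x) ≤ A * ((1 + B) * (2 + 8 * R ^ 2) ^ 2) * energy v := fun x v hx => by
    calc energy (U.symm x) ≤ A * energy x := hA x
      _ ≤ A * ((1 + B) * energy (T v)) := by gcongr
      _ ≤ A * ((1 + B) * ((2 + 8 * R ^ 2) ^ 2 * energy v)) := by gcongr; exact hTe v
      _ = _ := by ring
  have hW := hUs.comp ((isIsom_extendPlus L).comp hT)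
  rcases hW.det with hd | hd
  · obtain ⟨g, hg⟩ := hW.exists_group hd
    refine ⟨g, fun v => ?_, ?_, ?_⟩
    · rw [hg]
      refine bound _ v ?_
      rw [LinearMap.comp_apply, energy_extendPlus]
      nlinarith [energy_nonneg (T v)]
    · rw [hg, LinearMap.comp_apply, LinearMap.comp_apply, hp, ← hU]; simp
    · rw [hg, LinearMap.comp_apply, LinearMap.comp_apply, hq, ← hU]; simp
  · obtain ⟨g, hg⟩ := (hUs.comp ((isIsom_refl hw).comp
      ((isIsom_extendPlus L).comp hT))).exists_group (by
        rw [LinearMap.det_comp] at hd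
        rw [LinearMap.det_comp, LinearMap.det_comp _ (_ ∘ₗ T), det_refl hw]
        linear_combination -hd)
    refine ⟨g, fun v => ?_, ?_, ?_⟩
    · rw [hg]
      refine bound _ v ((hB _).trans ?_)
      rw [LinearMap.comp_apply, energy_extendPlus]
      nlinarith [energy_nonneg (T v)]
    · rw [hg, LinearMap.comp_apply, LinearMap.comp_apply, LinearMap.comp_apply, hp, hfix _ hp₀,
        ← hU]; simp
    · rw [hg, LinearMap.comp_apply, LinearMap.comp_apply, LinearMap.comp_apply, hq, hfix _ hq₀,
        ← hU]; simp

/-! ### Compact subsets of the group -/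

theorem isClosedEmbedding_mat : Topology.IsClosedEmbedding mat := by
  have hG : IsClosed (G : Set (Matrix.SpecialLinearGroup Idx ℝ)) := by
    have hc : Continuous fun g : Matrix.SpecialLinearGroup Idx ℝ => (g : Matrix Idx Idx ℝ) :=
      Matrix.SpecialLinearGroup.isClosedEmbedding_val.continuous
    exact isClosed_eq ((hc.matrix_transpose.matrix_mul continuous_const).matrix_mul hc)
      continuous_const
  exact Matrix.SpecialLinearGroup.isClosedEmbedding_val.comp hG.isClosedEmbedding_subtypeVal

/-- Basis vectors have energy `1`, so the bound confines every matrix entry to `[-√C, √C]`, and the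
group is closed in the space of matrices. -/
theorem exists_isCompact_of_energy_le (C : ℝ) :
    ∃ K : Set G, IsCompact K ∧
      ∀ g, (∀ v, energy ((mat g).mulVec v) ≤ C * energy v) → g ∈ K := by
  have hK : IsCompact (Set.univ.pi fun _ : Idx => Set.univ.pi fun _ : Idx => Set.Icc (-√C) √C) :=
    isCompact_univ_pi fun _ => isCompact_univ_pi fun _ => isCompact_Icc
  refine ⟨_, isClosedEmbedding_mat.isCompact_preimage hK, fun g hg => ?_⟩
  intro i _ j _
  have h := (sq_apply_le_energy _ i).trans (hg (Pi.single j 1))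
  rw [energy_single, mul_one, Matrix.mulVec_single_one] at h
  exact abs_le.1 (Real.abs_le_sqrt h)


/-! ### The projection to the distinguished `𝔰𝔩₂` -/

theorem trace_wedge_mul_wedge {R : Type*} [CommRing R] (v w x y : V R) :
    (wedge v w * wedge x y).trace = 2 * (bil w x * bil v y - bil v x * bil w y) := by
  have key : ∀ a b c d : V R, (Matrix.vecMulVec a ((J R).mulVec b) *
      Matrix.vecMulVec c ((J R).mulVec d)).trace = bil b c * bil a d := by
    intro a b c d
    rw [Matrix.vecMulVec_mul_vecMulVec, Matrix.trace_vecMulVec, dotProduct_smul, smul_eq_mul,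
      dotProduct_comm _ c, ← bil, ← bil, bil_comm c]
  simp only [wedge, Matrix.sub_mul, Matrix.mul_sub, Matrix.trace_sub, key]
  ring

/-- The complexification of a real vector. -/
def toComplex (v : V ℝ) : V ℂ := fun i => (v i : ℂ)

theorem map_wedge (v w : V ℝ) :
    (wedge v w).map (fun t : ℝ => (t : ℂ)) = wedge (toComplex v) (toComplex w) := by
  have hJ : ∀ v : V ℝ, (J ℂ).mulVec (toComplex v) = toComplex ((J ℝ).mulVec v) := by
    intro v
    ext i
    rcases i with i | i <;> simp [J, toComplex, Matrix.fromBlocks_mulVec]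
  ext i j
  simp only [wedge, hJ, Matrix.map_apply, Matrix.sub_apply, Matrix.vecMulVec_apply, toComplex]
  push_cast
  rfl

theorem bil_toComplex_frame (v : V ℝ) (j : Fin 4) :
    bil (toComplex v) (frame j) = (plus v j : ℂ) := by
  simp [bil_eq_sum, frame, toComplex, plus, Pi.single_apply, Finset.sum_add_distrib]
  ring

theorem bil_frame (i j : Fin 4) : bil (frame i) (frame j) = if i = j then 1 else 0 := by
  have h : (((√2 : ℝ) : ℂ)⁻¹) * (((√2 : ℝ) : ℂ)⁻¹) = 1 / 2 := by
    rw [← Complex.ofReal_inv, ← Complex.ofReal_mul, inv_sqrt_two_mul_self]; norm_num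
  simp only [bil_eq_sum, frame, Pi.smul_apply, Pi.add_apply, Pi.single_apply, smul_eq_mul,
    reduceCtorEq, if_false, add_zero, zero_add, Sum.inl.injEq, Sum.inr.injEq]
  split_ifs with hij
  · subst hij
    simp [h, Finset.sum_add_distrib]
    norm_num
  · refine Finset.sum_eq_zero fun x _ => ?_
    by_cases hx : x = i
    · have : x ≠ j := fun h => hij (hx.symm.trans h)
      simp [this]
    · simp [hx]

/-- The Plücker coordinates. -/
def pluecker (x y : E) (i j : Fin 4) : ℝ := x i * y j - x j * y i

theorem sub_smul_frame (i j : Fin 4) :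
    frame i - Complex.I • frame j = frame i + (-Complex.I) • frame j := by
  rw [neg_smul, sub_eq_add_neg]

theorem trace_ePlus_mul_fPlus : (ePlus * fPlus).trace = 2 := by
  simp [ePlus, fPlus, sub_smul_frame, trace_wedge_mul_wedge, bil_add_left, bil_add_right,
    bil_smul_left, bil_smul_right, bil_frame, -neg_smul]
  norm_num

theorem trace_hPlus_mul_hPlus : (hPlus * hPlus).trace = 4 := by
  simp [hPlus, trace_wedge_mul_wedge, bil_frame, Matrix.add_mul, Matrix.mul_add,
    Matrix.trace_add]
  ring_nf
  simp

theorem prSU2_map_wedge (v w : V ℝ) :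
    prSU2 ((wedge v w).map (fun t : ℝ => (t : ℂ))) =
      toSym2 (⟨(pluecker (plus v) (plus w) 0 2 - pluecker (plus v) (plus w) 1 3) / 2,
          (pluecker (plus v) (plus w) 0 3 + pluecker (plus v) (plus w) 1 2) / 2⟩)
        ⟨0, -(pluecker (plus v) (plus w) 0 1 + pluecker (plus v) (plus w) 2 3) / 2⟩
        ⟨-(pluecker (plus v) (plus w) 0 2 - pluecker (plus v) (plus w) 1 3) / 2,
          (pluecker (plus v) (plus w) 0 3 + pluecker (plus v) (plus w) 1 2) / 2⟩ := by
  rw [prSU2, Matrix.trace_mul_comm fPlus, trace_ePlus_mul_fPlus, trace_hPlus_mul_hPlus, map_wedge]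
  congr 1
  · simp only [fPlus, Matrix.mul_smul, Matrix.trace_smul, trace_wedge_mul_wedge, bil_add_right,
      bil_smul_right, bil_toComplex_frame, pluecker, smul_eq_mul]
    apply Complex.ext <;> simp <;> ring
  · simp only [hPlus, Matrix.mul_smul, Matrix.mul_add, Matrix.trace_add, Matrix.trace_smul,
      trace_wedge_mul_wedge, bil_toComplex_frame, pluecker, smul_eq_mul]
    apply Complex.ext <;> simp
    ring
  · simp only [ePlus, sub_smul_frame, Matrix.mul_smul, Matrix.trace_smul, trace_wedge_mul_wedge,
      bil_add_right, bil_smul_right, bil_toComplex_frame, pluecker, smul_eq_mul]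
    apply Complex.ext <;> simp <;> ring

theorem coe_toSym2 (a b c : ℂ) : (toSym2 a b c : MvPolynomial (Fin 2) ℂ) =
    MvPolynomial.monomial (Finsupp.single 0 2) (-a) +
      MvPolynomial.monomial (Finsupp.single 0 1 + Finsupp.single 1 1) (2 * b) +
      MvPolynomial.monomial (Finsupp.single 1 2) c := by
  have h1 : (2 * MvPolynomial.X 0 * MvPolynomial.X 1 : MvPolynomial (Fin 2) ℂ) =
      MvPolynomial.monomial (Finsupp.single 0 1 + Finsupp.single 1 1) 2 := by
    rw [MvPolynomial.X, MvPolynomial.X, mul_assoc, MvPolynomial.monomial_mul, one_mul,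
      ← map_ofNat (MvPolynomial.C : ℂ →+* MvPolynomial (Fin 2) ℂ) 2, MvPolynomial.C_mul_monomial,
      mul_one]
  simp only [toSym2, h1, MvPolynomial.X_pow_eq_monomial, smul_neg, MvPolynomial.smul_monomial,
    smul_eq_mul, mul_one, map_neg, mul_comm b]

theorem symNorm_nonneg (k : ℕ) (p : Sym k) : 0 ≤ symNorm k p := Real.sqrt_nonneg _

theorem symNorm_toSym2_sq (a b c : ℂ) :
    symNorm 2 (toSym2 a b c) ^ 2 = ‖a‖ ^ 2 + 2 * ‖b‖ ^ 2 + ‖c‖ ^ 2 := by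
  rw [symNorm, Real.sq_sqrt (Finset.sum_nonneg fun _ _ => by positivity)]
  simp [Finset.sum_range_succ, coe_toSym2, MvPolynomial.coeff_monomial, Finsupp.ext_iff,
    Fin.forall_fin_two]
  ring

theorem area_eq_sum_pluecker (x y : E) : area x y ^ 2 =
    pluecker x y 0 1 ^ 2 + pluecker x y 0 2 ^ 2 + pluecker x y 0 3 ^ 2 + pluecker x y 1 2 ^ 2 +
      pluecker x y 1 3 ^ 2 + pluecker x y 2 3 ^ 2 := by
  rw [area_sq, EuclideanSpace.norm_sq_eq, EuclideanSpace.norm_sq_eq, PiLp.inner_apply]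
  simp only [Fin.sum_univ_four, Real.norm_eq_abs, sq_abs, RCLike.inner_apply, conj_trivial,
    pluecker]
  ring

/-- The squares of `P₀₁ + P₂₃`, `P₀₂ - P₁₃` and `P₀₃ + P₁₂` add up to the squared area, the cross
terms cancelling by the Plücker relation `P₀₁P₂₃ - P₀₂P₁₃ + P₀₃P₁₂ = 0`. -/
theorem symNorm_prSU2_sq (v w : V ℝ) :
    symNorm 2 (prSU2 ((wedge v w).map (fun t : ℝ => (t : ℂ)))) ^ 2 =
      area (plus v) (plus w) ^ 2 / 2 := by
  rw [prSU2_map_wedge, symNorm_toSym2_sq, area_eq_sum_pluecker]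
  simp only [Complex.sq_norm, Complex.normSq_mk, pluecker]
  ring

/-! ### Coefficient bounds for powers of quadratic forms -/

theorem symNorm_smul (k : ℕ) (a : ℂ) (p : Sym k) : symNorm k (a • p) = ‖a‖ * symNorm k p := by
  rw [symNorm, symNorm, ← Real.sqrt_sq (norm_nonneg a), ← Real.sqrt_mul (sq_nonneg _),
    Finset.mul_sum]
  simp only [SetLike.val_smul, MvPolynomial.coeff_smul, smul_eq_mul, norm_mul, mul_pow, mul_div_assoc]

theorem symNorm_le {k : ℕ} {p : Sym k} {M : ℝ} (hM : 0 ≤ M)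
    (h : ∀ m, ‖MvPolynomial.coeff m (p : MvPolynomial (Fin 2) ℂ)‖ ≤ M) :
    symNorm k p ≤ √(k + 1) * M := by
  rw [symNorm, ← Real.sqrt_sq hM, ← Real.sqrt_mul (by positivity)]
  apply Real.sqrt_le_sqrt
  calc _ ≤ ∑ _ ∈ Finset.range (k + 1), M ^ 2 := by
        refine Finset.sum_le_sum fun j hj => ?_
        have : (1 : ℝ) ≤ k.choose j := by
          exact_mod_cast Nat.choose_pos (Nat.lt_succ_iff.1 (Finset.mem_range.1 hj))
        exact (div_le_self (by positivity) this).trans (by gcongr; exact h _)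
    _ = _ := by simp

/-- Multiplication by a polynomial enlarges the largest coefficient at most by the sum of the
absolute values of its coefficients. -/
theorem norm_coeff_toSym2_pow_le {a b c : ℂ} {M : ℝ} (hM : ‖a‖ + 2 * ‖b‖ + ‖c‖ ≤ M) (n : ℕ)
    (m : Fin 2 →₀ ℕ) :
    ‖MvPolynomial.coeff m ((toSym2 a b c : MvPolynomial (Fin 2) ℂ) ^ n)‖ ≤ M ^ n := by
  have hM0 : 0 ≤ M := le_trans (by positivity) hM
  induction n generalizing m with
  | zero =>
    rw [pow_zero, pow_zero, MvPolynomial.coeff_one]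
    split_ifs <;> simp
  | succ n ih =>
    have key : ∀ (s : Fin 2 →₀ ℕ) (r : ℂ), ‖MvPolynomial.coeff m
        ((toSym2 a b c : MvPolynomial (Fin 2) ℂ) ^ n * MvPolynomial.monomial s r)‖ ≤
          M ^ n * ‖r‖ := by
      intro s r
      rw [MvPolynomial.coeff_mul_monomial']
      split_ifs
      · rw [norm_mul]; gcongr; exact ih _
      · rw [norm_zero]; positivity
    have h1 := key (Finsupp.single 0 2) (-a)
    have h2 := key (Finsupp.single 0 1 + Finsupp.single 1 1) (2 * b)
    have h3 := key (Finsupp.single 1 2) c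
    rw [norm_neg] at h1
    rw [norm_mul, Complex.norm_ofNat] at h2
    rw [pow_succ]
    nth_rewrite 2 [coe_toSym2]
    rw [mul_add, mul_add, MvPolynomial.coeff_add, MvPolynomial.coeff_add]
    calc _ ≤ M ^ n * ‖a‖ + M ^ n * (2 * ‖b‖) + M ^ n * ‖c‖ :=
          norm_add_le_of_le (norm_add_le_of_le h1 h2) h3
      _ = M ^ n * (‖a‖ + 2 * ‖b‖ + ‖c‖) := by ring
      _ ≤ M ^ n * M := by gcongr
      _ = _ := (pow_succ _ _).symm

theorem continuous_coeff_toSym2_pow {X : Type*} [TopologicalSpace X] {a b c : X → ℂ}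
    (ha : Continuous a) (hb : Continuous b) (hc : Continuous c) (n : ℕ) (m : Fin 2 →₀ ℕ) :
    Continuous fun x =>
      MvPolynomial.coeff m ((toSym2 (a x) (b x) (c x) : MvPolynomial (Fin 2) ℂ) ^ n) := by
  induction n generalizing m with
  | zero => simpa using continuous_const
  | succ n ih =>
    have key : ∀ (s : Fin 2 →₀ ℕ) (r : X → ℂ), Continuous r → Continuous fun x =>
        MvPolynomial.coeff m ((toSym2 (a x) (b x) (c x) : MvPolynomial (Fin 2) ℂ) ^ n *
          MvPolynomial.monomial s (r x)) := by
      intro s r hr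
      simp only [MvPolynomial.coeff_mul_monomial']
      split_ifs
      · exact (ih _).mul hr
      · exact continuous_const
    have h := ((key (Finsupp.single 0 2) _ ha.neg).add
      (key (Finsupp.single 0 1 + Finsupp.single 1 1) _ ((continuous_const (y := (2 : ℂ))).mul hb))).add
        (key (Finsupp.single 1 2) _ hc)
    refine h.congr fun x => ?_
    rw [pow_succ]
    nth_rewrite 2 [coe_toSym2]
    rw [mul_add, mul_add, MvPolynomial.coeff_add, MvPolynomial.coeff_add]
    rfl

theorem symNorm_symPow_toSym2_le (ℓ : ℕ) (a b c : ℂ) :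
    symNorm (2 * ℓ) (symPow ℓ (toSym2 a b c)) ≤
      √(2 * ℓ + 1) * (4 * symNorm 2 (toSym2 a b c)) ^ ℓ := by
  have h0 := symNorm_nonneg 2 (toSym2 a b c)
  have h := symNorm_toSym2_sq a b c
  -- Cauchy–Schwarz would give the constant 2; any constant serves.
  have h1 : ‖a‖ + 2 * ‖b‖ + ‖c‖ ≤ 4 * symNorm 2 (toSym2 a b c) := by
    refine abs_le_of_sq_le_sq' ?_ (by positivity) |>.2
    rw [mul_pow, h]
    nlinarith [sq_nonneg (‖a‖ - ‖c‖), sq_nonneg (‖a‖ - ‖b‖), sq_nonneg (‖b‖ - ‖c‖),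
      sq_nonneg ‖a‖, sq_nonneg ‖b‖, sq_nonneg ‖c‖]
  have := symNorm_le (p := symPow ℓ (toSym2 a b c)) (by positivity)
    (norm_coeff_toSym2_pow_le h1 ℓ)
  exact_mod_cast this


/-! ### The area function on the homogeneous space -/

/-- Gram–Schmidt. The change of basis is triangular, so areas scale by the constant `|a * c|`. -/
theorem SpansPosDefPlane.exists_isFrame {v₁ v₂ : V ℝ} (hv : SpansPosDefPlane v₁ v₂) :
    ∃ (p q : V ℝ) (a b c : ℝ), IsFrame p q ∧ a ≠ 0 ∧ c ≠ 0 ∧ v₁ = a • p ∧ v₂ = b • p + c • q := by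
  obtain ⟨hli, hpos⟩ := hv
  have m₁ : v₁ ∈ Submodule.span ℝ ({v₁, v₂} : Set (V ℝ)) := Submodule.subset_span (by simp)
  have m₂ : v₂ ∈ Submodule.span ℝ ({v₁, v₂} : Set (V ℝ)) := Submodule.subset_span (by simp)
  have hA := hpos v₁ m₁ (hli.ne_zero 0)
  set a := √(bil v₁ v₁)
  have ha : a ≠ 0 := (Real.sqrt_pos.2 hA).ne'
  have ha2 : a ^ 2 = bil v₁ v₁ := Real.sq_sqrt hA.le
  set p := a⁻¹ • v₁ with hp
  have hpp : bil p p = 1 := by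
    rw [hp, bil_smul_left, bil_smul_right, ← ha2]
    field_simp
  set b := bil p v₂
  have hw0 : v₂ - b • p ≠ 0 := by
    intro h
    rw [LinearIndependent.pair_iff] at hli
    have := (hli (-(b * a⁻¹)) 1 (by rw [← h, hp]; module)).2
    exact one_ne_zero this
  have hC := hpos _ (Submodule.sub_mem _ m₂ (Submodule.smul_mem _ b
    (Submodule.smul_mem _ a⁻¹ m₁))) hw0
  have hpw : bil p (v₂ - b • p) = 0 := by
    rw [sub_eq_add_neg, bil_add_right, ← neg_smul, bil_smul_right, hpp]
    ring
  set w := v₂ - b • p with hw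
  set c := √(bil w w)
  have hc : c ≠ 0 := (Real.sqrt_pos.2 hC).ne'
  have hc2 : c ^ 2 = bil w w := Real.sq_sqrt hC.le
  refine ⟨p, c⁻¹ • w, a, b, c, ⟨hpp, ?_, ?_⟩, ha, hc, (smul_inv_smul₀ ha _).symm, ?_⟩
  · rw [bil_smul_left, bil_smul_right, ← hc2]
    field_simp
  · rw [bil_smul_right, hpw, mul_zero]
  · rw [smul_inv_smul₀ hc, hw]
    module

theorem IsFrame.one_le_area {p q : V ℝ} (h : IsFrame p q) : 1 ≤ area (plus p) (plus q) := by
  obtain ⟨a, b, hab, h', h0, -⟩ := h.exists_rotation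
  rw [← area_rotate plus hab, area_of_inner_eq_zero h0]
  nlinarith [one_le_norm_plus h'.left, one_le_norm_plus h'.right]

/-- The area of the `V⁺`-components of `g⁻¹ v₁` and `g⁻¹ v₂`. -/
noncomputable def orbitArea (v₁ v₂ : V ℝ) (g : G) : ℝ :=
  area (plus ((mat g⁻¹).mulVec v₁)) (plus ((mat g⁻¹).mulVec v₂))

theorem orbitArea_linear_comb (a b c : ℝ) (p q : V ℝ) (g : G) :
    orbitArea (a • p) (b • p + c • q) g = |a * c| * orbitArea p q g := by
  have := area_linear_comb a 0 b c (plus ((mat g⁻¹).mulVec p)) (plus ((mat g⁻¹).mulVec q))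
  rw [zero_mul, sub_zero, zero_smul, add_zero] at this
  rw [orbitArea, orbitArea, ← this, Matrix.mulVec_add, Matrix.mulVec_smul, Matrix.mulVec_smul,
    Matrix.mulVec_smul, map_add, map_smul, map_smul, map_smul]

theorem orbitArea_mul (v₁ v₂ : V ℝ) (g k : G) :
    orbitArea v₁ v₂ (g * k) = area (plus ((mat k⁻¹).mulVec ((mat g⁻¹).mulVec v₁)))
      (plus ((mat k⁻¹).mulVec ((mat g⁻¹).mulVec v₂))) := by
  rw [orbitArea, mul_inv_rev, mat_mul, ← Matrix.mulVec_mulVec, ← Matrix.mulVec_mulVec]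

theorem continuous_plus_inv_mulVec (v : V ℝ) : Continuous fun g : G => plus ((mat g⁻¹).mulVec v) :=
  (LinearMap.continuous_of_finiteDimensional plus).comp
    ((isClosedEmbedding_mat.continuous.comp continuous_inv).matrix_mulVec continuous_const)

theorem continuous_orbitArea (v₁ v₂ : V ℝ) : Continuous (orbitArea v₁ v₂) := by
  have h₁ := continuous_plus_inv_mulVec v₁
  have h₂ := continuous_plus_inv_mulVec v₂
  exact (((h₁.norm.pow 2).mul (h₂.norm.pow 2)).sub ((h₁.inner h₂).pow 2)).sqrt

/-- The coset of `g`. -/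
def HQuot.mk (v₁ v₂ : V ℝ) (g : G) : HQuot v₁ v₂ := Quotient.mk (QuotientGroup.rightRel (H v₁ v₂)) g

theorem HQuot.mk_surjective (v₁ v₂ : V ℝ) : Function.Surjective (HQuot.mk v₁ v₂) :=
  Quotient.mk_surjective

theorem HQuot.continuous_mk (v₁ v₂ : V ℝ) : Continuous (HQuot.mk v₁ v₂) := continuous_quotient_mk'

theorem HQuot.isQuotientMap_mk (v₁ v₂ : V ℝ) : Topology.IsQuotientMap (HQuot.mk v₁ v₂) :=
  isQuotientMap_quotient_mk'

theorem HQuot.mk_mul_left {v₁ v₂ : V ℝ} {h : G} (hh : h ∈ H v₁ v₂) (g : G) :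
    HQuot.mk v₁ v₂ (h * g) = HQuot.mk v₁ v₂ g := by
  refine Quotient.sound ?_
  change QuotientGroup.rightRel (H v₁ v₂) (h * g) g
  rw [QuotientGroup.rightRel_apply]
  simpa using (H v₁ v₂).inv_mem hh

theorem rightTranslate_mk (v₁ v₂ : V ℝ) (g k : G) :
    rightTranslate v₁ v₂ k (HQuot.mk v₁ v₂ g) = HQuot.mk v₁ v₂ (g * k) := rfl

theorem continuous_rightTranslate (v₁ v₂ : V ℝ) (k : G) : Continuous (rightTranslate v₁ v₂ k) :=
  (HQuot.isQuotientMap_mk v₁ v₂).continuous_iff.2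
    ((HQuot.continuous_mk v₁ v₂).comp (continuous_mul_const k))

/-- The area of the `V⁺`-components of `g⁻¹ v₁` and `g⁻¹ v₂`, as a function of the coset of `g`. -/
noncomputable def quotArea (v₁ v₂ : V ℝ) : HQuot v₁ v₂ → ℝ :=
  Quotient.lift (orbitArea v₁ v₂) (by
    intro a b hab
    change QuotientGroup.rightRel (H v₁ v₂) a b at hab
    rw [QuotientGroup.rightRel_apply] at hab
    have hinv := (H v₁ v₂).inv_mem hab
    conv_rhs => rw [← inv_mul_cancel_right b a]
    rw [orbitArea_mul, hinv.1, hinv.2, orbitArea])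

theorem quotArea_mk (v₁ v₂ : V ℝ) (g : G) : quotArea v₁ v₂ (HQuot.mk v₁ v₂ g) = orbitArea v₁ v₂ g :=
  rfl

theorem continuous_quotArea (v₁ v₂ : V ℝ) : Continuous (quotArea v₁ v₂) :=
  (HQuot.isQuotientMap_mk v₁ v₂).continuous_iff.2 (continuous_orbitArea v₁ v₂)

theorem SpansPosDefPlane.exists_pos_le_quotArea {v₁ v₂ : V ℝ} (hv : SpansPosDefPlane v₁ v₂) :
    ∃ r > 0, ∀ x, r ≤ quotArea v₁ v₂ x := by
  obtain ⟨p, q, a, b, c, h, ha, hc, rfl, rfl⟩ := hv.exists_isFrame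
  refine ⟨|a * c|, abs_pos.2 (mul_ne_zero ha hc), fun x => ?_⟩
  obtain ⟨g, rfl⟩ := HQuot.mk_surjective _ _ x
  rw [quotArea_mk, orbitArea_linear_comb]
  exact le_mul_of_one_le_right (abs_nonneg _) (h.mat_mulVec g⁻¹).one_le_area

theorem SpansPosDefPlane.measure_quotArea_le_lt_top {v₁ v₂ : V ℝ} (hv : SpansPosDefPlane v₁ v₂)
    (μ : Measure (HQuot v₁ v₂)) [IsLocallyFiniteMeasure μ] (R : ℝ) :
    μ {x | quotArea v₁ v₂ x ≤ R} < ⊤ := by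
  obtain ⟨p, q, a, b, c, h, ha, hc, rfl, rfl⟩ := hv.exists_isFrame
  obtain ⟨C, hC⟩ := h.exists_bounded_group (R / |a * c|)
  obtain ⟨K, hK, hKC⟩ := exists_isCompact_of_energy_le C
  refine (measure_mono ?_).trans_lt (hK.image (HQuot.continuous_mk _ _)).measure_lt_top
  intro x hx
  obtain ⟨g, rfl⟩ := HQuot.mk_surjective _ _ x
  rw [Set.mem_ofPred_eq, quotArea_mk, orbitArea_linear_comb, mul_comm,
    ← le_div_iff₀ (abs_pos.2 (mul_ne_zero ha hc))] at hx
  obtain ⟨k, hk, hp, hq⟩ := hC _ _ (h.mat_mulVec g⁻¹) hx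
  refine ⟨k, hKC k hk, ?_⟩
  rw [Matrix.mulVec_mulVec, ← mat_mul] at hp hq
  -- Thus `g` and the bounded element `k` represent the same coset.
  have hmem : k * g⁻¹ ∈ H (a • p) (b • p + c • q) :=
    ⟨by rw [Matrix.mulVec_smul, hp], by
      rw [Matrix.mulVec_add, Matrix.mulVec_smul, Matrix.mulVec_smul, hp, hq]⟩
  rw [← HQuot.mk_mul_left hmem g, inv_mul_cancel_right]

/-- Sublevel sets of the area grow polynomially. -/
theorem SpansPosDefPlane.exists_measure_quotArea_le {v₁ v₂ : V ℝ} (hv : SpansPosDefPlane v₁ v₂)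
    {μ : Measure (HQuot v₁ v₂)} (hμ : IsRightInvariant μ) :
    ∃ R₀ > 0, ∀ R ≥ R₀, μ {x | quotArea v₁ v₂ x ≤ 128 * R} ≤
      ((4097 ^ 8 + 1 : ℕ) : ENNReal) * μ {x | quotArea v₁ v₂ x ≤ R} := by
  obtain ⟨I, γ, hI, hγ⟩ := exists_contracting
  have hmeas : ∀ (k : G) (R : ℝ), μ (rightTranslate v₁ v₂ k ⁻¹' {x | quotArea v₁ v₂ x ≤ R}) =
      μ {x | quotArea v₁ v₂ x ≤ R} := by
    intro k R
    rw [← Measure.map_apply (continuous_rightTranslate v₁ v₂ k).measurable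
      (measurableSet_le (continuous_quotArea v₁ v₂).measurable measurable_const), hμ k]
  obtain ⟨p, q, a, b, c, h, ha, hc, rfl, rfl⟩ := hv.exists_isFrame
  have hr : 0 < |a * c| := abs_pos.2 (mul_ne_zero ha hc)
  -- The contraction threshold `2 ^ 20` for orthonormal pairs, rescaled to `v₁`, `v₂`.
  refine ⟨|a * c| * 2 ^ 20, by positivity, fun R hR => ?_⟩
  have hsub : {x | quotArea (a • p) (b • p + c • q) x ≤ 128 * R} ⊆
      {x | quotArea (a • p) (b • p + c • q) x ≤ R} ∪
        ⋃ i ∈ I, rightTranslate _ _ (γ i)⁻¹ ⁻¹' {x | quotArea (a • p) (b • p + c • q) x ≤ R} := by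
    intro x hx
    obtain ⟨g, rfl⟩ := HQuot.mk_surjective _ _ x
    rcases le_or_gt (quotArea (a • p) (b • p + c • q) (HQuot.mk _ _ g)) R with hle | hlt
    · exact Or.inl hle
    · right
      rw [quotArea_mk, orbitArea_linear_comb] at hlt
      rw [Set.mem_ofPred_eq, quotArea_mk, orbitArea_linear_comb] at hx
      obtain ⟨i, hi, hle⟩ := hγ _ _ (h.mat_mulVec g⁻¹)
        (le_of_mul_le_mul_left (hR.trans hlt.le) hr)
      refine Set.mem_biUnion hi ?_
      -- The area is taken at `g⁻¹`, so translation on the right by the inverse of `γ i` applies `γ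
      -- i` to the pair.
      rw [Set.mem_preimage, rightTranslate_mk, Set.mem_ofPred_eq, quotArea_mk,
        orbitArea_linear_comb, orbitArea_mul, inv_inv]
      calc _ ≤ |a * c| * (orbitArea p q g / 128) := by gcongr; exact hle
        _ ≤ R := by linarith
  refine (measure_mono hsub).trans ((measure_union_le _ _).trans ?_)
  calc _ ≤ μ {x | quotArea (a • p) (b • p + c • q) x ≤ R} +
        ∑ i ∈ I, μ (rightTranslate _ _ (γ i)⁻¹ ⁻¹'
          {x | quotArea (a • p) (b • p + c • q) x ≤ R}) := by
        gcongr; exact measure_biUnion_finset_le _ _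
    _ = _ := by
      simp only [hmeas, Finset.sum_const, hI, nsmul_eq_mul]
      push_cast
      ring

/-! ### Integrability from polynomial growth -/

/-- On the shell between consecutive radii `κ ^ k * R₀` the function decays like `ε ^ k` while the
measure grows at most like `N ^ k`; the integral is dominated by a geometric series of ratio `N *
ε`. -/
theorem lintegral_lt_top_of_growth {X : Type*} [MeasurableSpace X] {μ : Measure X} {D : X → ℝ}
    (hD : Measurable D) {κ R₀ K ε : ℝ} {N : ℕ} (hκ : 1 < κ) (hR₀ : 0 < R₀) (hε : 0 < ε)
    (hN : N * ε < 1) (hfin : μ {x | D x ≤ R₀} < ⊤)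
    (hgrowth : ∀ R ≥ R₀, μ {x | D x ≤ κ * R} ≤ (N : ENNReal) * μ {x | D x ≤ R}) {f : X → ℝ}
    (hf₀ : ∀ x, f x ≤ K) (hf : ∀ (k : ℕ) x, κ ^ k * R₀ < D x → f x ≤ K * ε ^ (k + 1)) :
    ∫⁻ x, ENNReal.ofReal (f x) ∂μ < ⊤ := by
  let S : ℕ → Set X := fun k => {x | D x ≤ κ ^ k * R₀}
  have hSm : ∀ k, MeasurableSet (S k) := fun k => measurableSet_le hD measurable_const
  have hS : ∀ k, μ (S k) ≤ (N : ENNReal) ^ k * μ {x | D x ≤ R₀} := by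
    intro k
    induction k with
    | zero => simp [S]
    | succ k ih =>
      have h := hgrowth (κ ^ k * R₀) (le_mul_of_one_le_left hR₀.le (one_le_pow₀ hκ.le))
      rw [← mul_assoc, ← pow_succ'] at h
      calc _ ≤ (N : ENNReal) * μ (S k) := h
        _ ≤ N * (N ^ k * μ {x | D x ≤ R₀}) := by gcongr
        _ = _ := by rw [pow_succ']; ring
  -- Whole sublevel sets replace the shells: one term, at the first `k` with `x ∈ S k`, already
  -- dominates `f x`.
  have hpt : ∀ x, ENNReal.ofReal (f x) ≤
      ∑' k, (S k).indicator (fun _ => ENNReal.ofReal (K * ε ^ k)) x := by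
    intro x
    have hex : ∃ k : ℕ, D x ≤ κ ^ k * R₀ := by
      obtain ⟨k, hk⟩ := pow_unbounded_of_one_lt (D x / R₀) hκ
      exact ⟨k, ((div_lt_iff₀ hR₀).1 hk).le⟩
    classical
    have hmin : f x ≤ K * ε ^ Nat.find hex := by
      rcases hk : Nat.find hex with _ | k
      · simpa using hf₀ x
      · exact hf k x (not_le.1 (Nat.find_min hex (hk ▸ k.lt_succ_self)))
    refine le_trans ?_ (ENNReal.le_tsum (Nat.find hex))
    rw [Set.indicator_of_mem (show x ∈ S _ from Nat.find_spec hex)]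
    exact ENNReal.ofReal_le_ofReal hmin
  calc ∫⁻ x, ENNReal.ofReal (f x) ∂μ
      ≤ ∫⁻ x, ∑' k, (S k).indicator (fun _ => ENNReal.ofReal (K * ε ^ k)) x ∂μ :=
        lintegral_mono hpt
    _ = ∑' k, ENNReal.ofReal (K * ε ^ k) * μ (S k) := by
      rw [lintegral_tsum fun k => (measurable_const.indicator (hSm k)).aemeasurable]
      simp only [lintegral_indicator_const (hSm _)]
    _ ≤ ∑' k, ENNReal.ofReal K * μ {x | D x ≤ R₀} * ENNReal.ofReal (N * ε) ^ k := by
      refine ENNReal.tsum_le_tsum fun k => ?_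
      rw [ENNReal.ofReal_mul' (by positivity), ENNReal.ofReal_mul (by positivity),
        ENNReal.ofReal_pow hε.le, ENNReal.ofReal_natCast, mul_pow]
      calc _ ≤ ENNReal.ofReal K * ENNReal.ofReal ε ^ k * (N ^ k * μ {x | D x ≤ R₀}) := by
            gcongr; exact hS k
        _ = _ := by ring
    _ < ⊤ := by
      rw [ENNReal.tsum_mul_left, ENNReal.tsum_geometric]
      refine ENNReal.mul_lt_top (ENNReal.mul_lt_top ENNReal.ofReal_lt_top hfin) ?_
      rw [ENNReal.inv_lt_top, tsub_pos_iff_lt]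
      exact ENNReal.ofReal_lt_one.2 hN

/-! ### The function `B` -/

theorem symNorm_prAd_sq (v₁ v₂ : V ℝ) (g : G) :
    symNorm 2 (prAd v₁ v₂ g) ^ 2 = orbitArea v₁ v₂ g ^ 2 / 2 := by
  rw [prAd, Ad_wedge, symNorm_prSU2_sq, orbitArea]

theorem symNorm_prAd (v₁ v₂ : V ℝ) (g : G) :
    symNorm 2 (prAd v₁ v₂ g) = orbitArea v₁ v₂ g / √2 := by
  rw [← Real.sqrt_sq (symNorm_nonneg _ _), symNorm_prAd_sq, Real.sqrt_div (sq_nonneg _),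
    Real.sqrt_sq (show 0 ≤ orbitArea v₁ v₂ g from area_nonneg _ _)]

theorem symNorm_B (ℓ : ℕ) (v₁ v₂ : V ℝ) (g : G) : symNorm (2 * ℓ) (B ℓ v₁ v₂ g) =
    (symNorm 2 (prAd v₁ v₂ g) ^ (2 * ℓ + 1))⁻¹ * symNorm (2 * ℓ) (symPow ℓ (prAd v₁ v₂ g)) := by
  rw [B, symNorm_smul, norm_inv, Complex.norm_real, Real.norm_eq_abs,
    abs_of_nonneg (pow_nonneg (symNorm_nonneg _ _) _)]

theorem symNorm_B_le (ℓ : ℕ) (v₁ v₂ : V ℝ) {g : G} (hg : 0 < orbitArea v₁ v₂ g) :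
    symNorm (2 * ℓ) (B ℓ v₁ v₂ g) ≤
      √(2 * ℓ + 1) * 4 ^ ℓ * √2 ^ (ℓ + 1) * (orbitArea v₁ v₂ g)⁻¹ ^ (ℓ + 1) := by
  have hN : 0 < symNorm 2 (prAd v₁ v₂ g) := by rw [symNorm_prAd]; positivity
  have h : symNorm (2 * ℓ) (symPow ℓ (prAd v₁ v₂ g)) ≤
      √(2 * ℓ + 1) * (4 * symNorm 2 (prAd v₁ v₂ g)) ^ ℓ := symNorm_symPow_toSym2_le ℓ _ _ _
  rw [symNorm_B]
  have hinv : (orbitArea v₁ v₂ g)⁻¹ * √2 = (symNorm 2 (prAd v₁ v₂ g))⁻¹ := by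
    rw [symNorm_prAd, inv_div, div_eq_inv_mul]
  calc _ ≤ (symNorm 2 (prAd v₁ v₂ g) ^ (2 * ℓ + 1))⁻¹ *
        (√(2 * ℓ + 1) * (4 * symNorm 2 (prAd v₁ v₂ g)) ^ ℓ) := by gcongr
    _ = √(2 * ℓ + 1) * 4 ^ ℓ * (symNorm 2 (prAd v₁ v₂ g))⁻¹ ^ (ℓ + 1) := by
      rw [show 2 * ℓ + 1 = ℓ + (ℓ + 1) by ring, pow_add, mul_pow, inv_pow]
      field_simp
    _ = _ := by rw [← hinv, mul_pow]; ring

theorem continuous_symNorm_B (ℓ : ℕ) {v₁ v₂ : V ℝ} (hpos : ∀ g, 0 < orbitArea v₁ v₂ g) :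
    Continuous fun g => symNorm (2 * ℓ) (B ℓ v₁ v₂ g) := by
  have hN : ∀ g, symNorm 2 (prAd v₁ v₂ g) ≠ 0 := fun g => by
    rw [symNorm_prAd]
    have := hpos g
    positivity
  have hc : Continuous fun g => symNorm 2 (prAd v₁ v₂ g) := by
    simp only [symNorm_prAd]
    exact (continuous_orbitArea v₁ v₂).div_const _
  have hcoord : ∀ (v : V ℝ) (i : Fin 4), Continuous fun g : G => plus ((mat g⁻¹).mulVec v) i :=
    fun v i => (EuclideanSpace.proj i).continuous.comp (continuous_plus_inv_mulVec v)
  have hP : ∀ i j, Continuous fun g : G =>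
      pluecker (plus ((mat g⁻¹).mulVec v₁)) (plus ((mat g⁻¹).mulVec v₂)) i j := fun i j =>
    ((hcoord v₁ i).mul (hcoord v₂ j)).sub ((hcoord v₁ j).mul (hcoord v₂ i))
  have hmk : ∀ {s t : G → ℝ}, Continuous s → Continuous t →
      Continuous fun g => (⟨s g, t g⟩ : ℂ) := fun hs ht =>
    Complex.equivRealProdCLM.symm.continuous.comp (hs.prodMk ht)
  have hcoeff : ∀ m, Continuous fun g =>
      MvPolynomial.coeff m (symPow ℓ (prAd v₁ v₂ g) : MvPolynomial (Fin 2) ℂ) := by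
    intro m
    simp only [symPow, prAd, Ad_wedge, prSU2_map_wedge]
    exact continuous_coeff_toSym2_pow
      (hmk (((hP 0 2).sub (hP 1 3)).div_const 2) (((hP 0 3).add (hP 1 2)).div_const 2))
      (hmk continuous_const (((hP 0 1).add (hP 2 3)).neg.div_const 2))
      (hmk (((hP 0 2).sub (hP 1 3)).neg.div_const 2) (((hP 0 3).add (hP 1 2)).div_const 2)) ℓ m
  simp only [symNorm_B]
  refine ((hc.pow _).inv₀ fun g => pow_ne_zero _ (hN g)).mul ?_
  exact (continuous_finsetSum _ fun j _ => ((hcoeff _).norm.pow 2).div_const _).sqrt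

end SplitSO8


/-! ### Integrability of `‖B‖` -/

theorem mainTheorem10 (ℓ : ℕ) (hℓ : 22 ≤ ℓ) (v₁ v₂ : SplitSO8.V ℝ)
    (hv : SplitSO8.SpansPosDefPlane v₁ v₂)
    (μ : MeasureTheory.Measure (SplitSO8.HQuot v₁ v₂))
    [MeasureTheory.IsLocallyFiniteMeasure μ]
    (hμ : SplitSO8.IsRightInvariant μ) :
    MeasureTheory.Integrable
      (fun x : SplitSO8.HQuot v₁ v₂ =>
        SplitSO8.symNorm (2 * ℓ) (SplitSO8.BQuot ℓ v₁ v₂ x)) μ := by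
  open SplitSO8 in
  obtain ⟨r, hr, hle⟩ := hv.exists_pos_le_quotArea
  have hpos : ∀ g, 0 < orbitArea v₁ v₂ g := fun g => hr.trans_le (hle (HQuot.mk v₁ v₂ g))
  obtain ⟨R₀, hR₀, hgrowth⟩ := hv.exists_measure_quotArea_le hμ
  have hcont : Continuous fun x : HQuot v₁ v₂ => symNorm (2 * ℓ) (BQuot ℓ v₁ v₂ x) :=
    (HQuot.isQuotientMap_mk v₁ v₂).continuous_iff.2 (continuous_symNorm_B ℓ hpos)
  refine ⟨hcont.aestronglyMeasurable, ?_⟩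
  rw [hasFiniteIntegral_iff_ofReal (Filter.Eventually.of_forall fun x => symNorm_nonneg _ _)]
  obtain ⟨A, hA0, hbound⟩ : ∃ A : ℝ, 0 ≤ A ∧
      ∀ x, symNorm (2 * ℓ) (BQuot ℓ v₁ v₂ x) ≤ A * (quotArea v₁ v₂ x)⁻¹ ^ (ℓ + 1) := by
    refine ⟨√(2 * ℓ + 1) * 4 ^ ℓ * √2 ^ (ℓ + 1), by positivity, fun x => ?_⟩
    obtain ⟨g, rfl⟩ := HQuot.mk_surjective _ _ x
    exact symNorm_B_le ℓ v₁ v₂ (hpos g)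
  -- The first summand bounds the function everywhere; the factor `128 ^ 23` in the second absorbs
  -- the shift from `ε ^ k` to `ε ^ (k + 1)`.
  let K : ℝ := A * (r⁻¹ ^ (ℓ + 1) + 128 ^ 23 * R₀⁻¹ ^ (ℓ + 1))
  refine lintegral_lt_top_of_growth (continuous_quotArea v₁ v₂).measurable (κ := 128) (R₀ := R₀)
    (K := K) (ε := (128 ^ 23)⁻¹) (N := 4097 ^ 8 + 1) (by norm_num) hR₀ (by positivity)
    (by norm_num) (hv.measure_quotArea_le_lt_top μ R₀) hgrowth (fun x => ?_) (fun k x hx => ?_)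
  · refine (hbound x).trans (mul_le_mul_of_nonneg_left ?_ hA0)
    calc _ ≤ r⁻¹ ^ (ℓ + 1) := by
          have := hle x
          have := hr.trans_le this
          gcongr
      _ ≤ _ := le_add_of_nonneg_right (by positivity)
  · refine (hbound x).trans ?_
    refine (mul_le_mul_of_nonneg_left ?_ hA0).trans_eq (mul_assoc A _ _).symm
    -- The bound `22 ≤ ℓ` enters only here, as `23 ≤ ℓ + 1`.
    have h128 : ((128 : ℝ) ^ k)⁻¹ ^ (ℓ + 1) ≤ ((128 : ℝ) ^ k)⁻¹ ^ 23 :=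
      pow_le_pow_of_le_one (by positivity) (inv_le_one_of_one_le₀ (one_le_pow₀ (by norm_num)))
        (by omega)
    have hpow : ((128 : ℝ) ^ k)⁻¹ ^ 23 = 128 ^ 23 * (128 ^ 23)⁻¹ ^ (k + 1) := by
      rw [pow_succ _ k, mul_left_comm, mul_inv_cancel₀ (by positivity), mul_one, inv_pow, inv_pow,
        ← pow_mul, ← pow_mul, mul_comm k]
    have hx0 := hr.trans_le (hle x)
    calc _ ≤ (128 ^ k * R₀)⁻¹ ^ (ℓ + 1) := by gcongr
      _ = ((128 : ℝ) ^ k)⁻¹ ^ (ℓ + 1) * R₀⁻¹ ^ (ℓ + 1) := by rw [mul_inv, mul_pow]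
      _ ≤ ((128 : ℝ) ^ k)⁻¹ ^ 23 * R₀⁻¹ ^ (ℓ + 1) := by gcongr
      _ = 128 ^ 23 * R₀⁻¹ ^ (ℓ + 1) * (128 ^ 23)⁻¹ ^ (k + 1) := by rw [hpow]; ring
      _ ≤ _ := by
        gcongr
        exact le_add_of_nonneg_left (by positivity)
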